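/- Let $[n]=\{1,\dots,n\}$ and let $X=(x_1,\dots,x_m)\in[n]^m$ be an access sequence. *Optimal BST cost.* An (offline) execution of $X$ starts with an arbitrary binary search tree $T_1$ on the key set $[n]$. For $t=1,\dots,m$, the key $x_t$ is accessed in $T_t$ at a cost equal to the number of nodes on the search path from the root of $T_t$ to $x_t$ (both ends included); then $T_t$ is reconfigured into a tree $T_{t+1}$ by a finite sequence of operations that begins with a pointer at the root. Each operation has cost $1$ and either moves the pointer to the left child, the right child or the parent of its current node, or rotates the current node with its parent. $\mathrm{OPT}(X)$ is the minimum total cost of an execution of $X$. *$k$-lazy finger bound.* Let $k\ge 1$ and let $T$ be a (static) binary search tree on $[n]$, with $d_T(x,y)$ the number of edges on the path between $x$ and $y$ in $T$. A finger strategy consists of $\vec f\in[k]^m$, where $f_t$ is the finger that serves the request $x_t$, and $\vec\ell\in[n]^k$, where $\ell_i$ is the initial location of finger $i$; a finger that serves a request is moved to the requested key, and fingers do not move otherwise. Its cost is $\sum_{t=1}^m\bigl(1+d_T(x_t,p_t)\bigr)$, where $p_t$ is the location of finger $f_t$ just before request $t$. $LF^k(X)$ is the minimum cost over all $T$, $\vec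 f$ and $\vec\ell$. **Theorem.** There is an absolute constant $C>0$ such that for all $n,m$, all $k\ge1$ and every $X\in[n]^m$, $$\mathrm{OPT}(X)\;\le\; C\,\log(k+1)\cdot LF^k(X).$$ -/

import Mathlib

namespace DynBST

/-! ### Binary search trees on the key set `[n]`, modelled by `Fin n` -/

/-- The keys of a binary tree in symmetric (in-order) order. -/
def inorder {α : Type} : BinaryTree α → List α
  | .nil => []
  | .node a l r => inorder l ++ a :: inorder r

/-- `T` is a binary search tree on `[n]`: in symmetric order its keys are `0, 1, …, n - 1`. So every
key occurs exactly once, and at each node the keys of the left subtree are smaller and those of the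
right subtree are larger than the key at the node. -/
def IsBST {n : ℕ} (T : BinaryTree (Fin n)) : Prop :=
  inorder T = List.finRange n

/-- The key at the root, if the tree is nonempty. -/
def rootKey {α : Type} : BinaryTree α → Option α
  | .nil => none
  | .node a _ _ => some a

/-- `IsChild T p c`: the key `c` sits at a (left or right) child of a node of `T` with key `p`. -/
def IsChild {α : Type} : BinaryTree α → α → α → Prop
  | .nil, _, _ => False
  | .node a l r, p, c =>
      (p = a ∧ (rootKey l = some c ∨ rootKey r = some c)) ∨ IsChild l p c ∨ IsChild r p c

/-- The underlying undirected graph of a tree, on the keys: the edges join parents and children. -/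
def treeGraph {α : Type} (T : BinaryTree α) : SimpleGraph α :=
  SimpleGraph.fromRel (IsChild T)

/-- The distance `d_T(x, y)`: the number of edges on the path from `x` to `y` in `T`. -/
noncomputable def treeDist {α : Type} (T : BinaryTree α) (x y : α) : ℕ :=
  (treeGraph T).dist x y

/-- The number of nodes on the search path of `x` in `T`, both the root and the node of `x` included
(that is, one plus the depth of `x`, if `T` is a search tree that contains `x`). -/
def searchCost {n : ℕ} : BinaryTree (Fin n) → Fin n → ℕ
  | .nil, _ => 0
  | .node a l r, x =>
      if x < a then 1 + searchCost l x
      else if a < x then 1 + searchCost r x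
      else 1

/-! ### The dynamic BST model -/

/-- What surrounds a subtree of a binary tree. `left a r c`: the subtree is the left subtree of a
node with key `a` and right subtree `r`, and `c` is what surrounds that node; `right a l c`: the
subtree is the right subtree of a node with key `a` and left subtree `l`. -/
inductive Context (α : Type) : Type
  | top : Context α
  | left (a : α) (r : BinaryTree α) (c : Context α) : Context α
  | right (a : α) (l : BinaryTree α) (c : Context α) : Context α

/-- Put a subtree back into its surroundings. -/
def Context.plug {α : Type} : Context α → BinaryTree α → BinaryTree α
  | .top, t => t
  | .left a r c, t => c.plug (.node a t r)
  | .right a l c, t => c.plug (.node a l t)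

/-- A binary tree with a pointer to one of its nodes: the subtree `sub` rooted at that node,
and its surroundings. -/
structure Cursor (α : Type) : Type where
  sub : BinaryTree α
  ctx : Context α

/-- The whole tree of a cursor. -/
def Cursor.tree {α : Type} (z : Cursor α) : BinaryTree α := z.ctx.plug z.sub

/-- The pointer at the root of `T`. -/
def Cursor.atRoot {α : Type} (T : BinaryTree α) : Cursor α := ⟨T, .top⟩

/-- The operations of unit cost: the pointer moves to the left child, to the right child or to the
parent of the current node, or the current node (with key `b`) is rotated with its parent (with key
`a`), the pointer staying at `b`. -/
inductive Step {α : Type} : Cursor α → Cursor α → Prop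
  | moveLeft (a b : α) (l₁ l₂ r : BinaryTree α) (c : Context α) :
      Step ⟨.node a (.node b l₁ l₂) r, c⟩ ⟨.node b l₁ l₂, .left a r c⟩
  | moveRight (a b : α) (l r₁ r₂ : BinaryTree α) (c : Context α) :
      Step ⟨.node a l (.node b r₁ r₂), c⟩ ⟨.node b r₁ r₂, .right a l c⟩
  | moveUpFromLeft (a : α) (t r : BinaryTree α) (c : Context α) :
      Step ⟨t, .left a r c⟩ ⟨.node a t r, c⟩
  | moveUpFromRight (a : α) (t l : BinaryTree α) (c : Context α) :
      Step ⟨t, .right a l c⟩ ⟨.node a l t, c⟩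
  | rotateRight (a b : α) (t₁ t₂ t₃ : BinaryTree α) (c : Context α) :
      Step ⟨.node b t₁ t₂, .left a t₃ c⟩ ⟨.node b t₁ (.node a t₂ t₃), c⟩
  | rotateLeft (a b : α) (t₁ t₂ t₃ : BinaryTree α) (c : Context α) :
      Step ⟨.node b t₂ t₃, .right a t₁ c⟩ ⟨.node b (.node a t₁ t₂) t₃, c⟩

/-- `Steps j z z'`: exactly `j` unit-cost operations lead from `z` to `z'`. -/
inductive Steps {α : Type} : ℕ → Cursor α → Cursor α → Prop
  | refl (z : Cursor α) : Steps 0 z z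
  | tail {j : ℕ} {z z' z'' : Cursor α} : Steps j z z' → Step z' z'' → Steps (j + 1) z z''

/-- `Reconfigures T j T'`: starting with the pointer at the root of `T`, exactly `j` pointer moves
and rotations turn `T` into `T'`. -/
def Reconfigures {α : Type} (T : BinaryTree α) (j : ℕ) (T' : BinaryTree α) : Prop :=
  ∃ z : Cursor α, Steps j (Cursor.atRoot T) z ∧ z.tree = T'

/-- `IsExecution T r`: an offline execution of an access sequence of length `m` in the dynamic BST
model. `T 0` is the initial BST (of free choice); access number `t` takes place in the tree `T t`,
which afterwards is reconfigured into `T (t + 1)` with `r t` pointer moves and rotations. -/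
def IsExecution {n m : ℕ} (T : Fin (m + 1) → BinaryTree (Fin n))
    (r : Fin m → ℕ) : Prop :=
  IsBST (T 0) ∧ ∀ t : Fin m, Reconfigures (T t.castSucc) (r t) (T t.succ)

/-- The cost of an execution on the access sequence `X`: for each access, the length of the search path plus the number of
pointer moves and rotations spent on the reconfiguration after it. -/
def executionCost {n m : ℕ} (X : Fin m → Fin n) (T : Fin (m + 1) → BinaryTree (Fin n))
    (r : Fin m → ℕ) : ℕ :=
  ∑ t : Fin m, (searchCost (T t.castSucc) (X t) + r t)

/-- The offline optimum: the minimum cost of an execution of `X`. -/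
noncomputable def OPT {n m : ℕ} (X : Fin m → Fin n) : ℕ :=
  sInf {c : ℕ | ∃ T r, IsExecution T r ∧ c = executionCost X T r}

/-! ### The `k`-lazy finger bound -/

/-- `fingerPos X f ℓ t i` is the location of finger `i` after the first `t` requests of `X` have
been served, where finger `f t` serves the request `X t` and finger `i` starts at `ℓ i`. -/
def fingerPos {n m k : ℕ} (X : Fin m → Fin n) (f : Fin m → Fin k) (ℓ : Fin k → Fin n) :
    ℕ → Fin k → Fin n
  | 0 => ℓ
  | t + 1 =>
      if h : t < m then Function.update (fingerPos X f ℓ t) (f ⟨t, h⟩) (X ⟨t, h⟩)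
      else fingerPos X f ℓ t

/-- The cost of the finger strategy `(f, ℓ)` on the reference tree `T`: each request costs one plus
the distance in `T` from the requested key to the location of the serving finger just before. -/
noncomputable def strategyCost {n m k : ℕ} (T : BinaryTree (Fin n)) (X : Fin m → Fin n)
    (f : Fin m → Fin k) (ℓ : Fin k → Fin n) : ℕ :=
  ∑ t : Fin m, (1 + treeDist T (X t) (fingerPos X f ℓ (t : ℕ) (f t)))

/-- `LF^k_T(X)`: the minimum cost of a strategy with `k` fingers on the reference tree `T`. -/
noncomputable def LFTree {n m : ℕ} (k : ℕ) (T : BinaryTree (Fin n)) (X : Fin m → Fin n) : ℕ :=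
  sInf {c : ℕ | ∃ (f : Fin m → Fin k) (ℓ : Fin k → Fin n), c = strategyCost T X f ℓ}

/-- `LF^k(X)`: the minimum of `LF^k_T(X)` over all reference trees `T` on `[n]`. -/
noncomputable def LF {n m : ℕ} (k : ℕ) (X : Fin m → Fin n) : ℕ :=
  sInf {c : ℕ | ∃ T : BinaryTree (Fin n), IsBST T ∧ c = LFTree k T X}

/-! ### The minima and distances above are genuine -/

theorem Step.inorder_tree {α : Type} {z z' : Cursor α} (h : Step z z') :
    inorder z'.tree = inorder z.tree := by
  have plug_congr : ∀ (c : Context α) (t t' : BinaryTree α), inorder t' = inorder t →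
      inorder (c.plug t') = inorder (c.plug t) := by
    intro c
    induction c with
    | top => exact fun _ _ h => h
    | left a r c ih => exact fun t t' h => ih _ _ (by simp [inorder, h])
    | right a l c ih => exact fun t t' h => ih _ _ (by simp [inorder, h])
  cases h <;> simp only [Cursor.tree, Context.plug] <;> exact plug_congr _ _ _ (by simp [inorder])

/-- All the trees of an execution are BSTs on `[n]`. -/
theorem Reconfigures.isBST {n j : ℕ} {T T' : BinaryTree (Fin n)} (h : Reconfigures T j T')
    (hT : IsBST T) : IsBST T' := by
  obtain ⟨z, hz, rfl⟩ := h
  have : ∀ {j : ℕ} {y z : Cursor (Fin n)}, Steps j y z → inorder z.tree = inorder y.tree := by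
    intro j y z hyz
    induction hyz with
    | refl => rfl
    | tail _ h ih => exact h.inorder_tree.trans ih
  exact (this hz).trans hT

theorem exists_inorder_eq {α : Type} (L : List α) : ∃ T : BinaryTree α, inorder T = L := by
  induction L with
  | nil => exact ⟨.nil, rfl⟩
  | cons a L ih =>
    obtain ⟨T, hT⟩ := ih
    exact ⟨.node a .nil T, by simp [inorder, hT]⟩

theorem exists_isBST (n : ℕ) : ∃ T : BinaryTree (Fin n), IsBST T :=
  exists_inorder_eq _

/-- Every access sequence has an execution, so that the minimum `OPT X` is attained. -/
theorem OPT_attained {n m : ℕ} (X : Fin m → Fin n) :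
    ∃ T r, IsExecution T r ∧ OPT X = executionCost X T r := by
  obtain ⟨T, hT⟩ := exists_isBST n
  have hne : {c : ℕ | ∃ T r, IsExecution T r ∧ c = executionCost X T r}.Nonempty :=
    ⟨_, fun _ => T, fun _ => 0, ⟨hT, fun _ => ⟨_, Steps.refl _, rfl⟩⟩, rfl⟩
  exact Nat.sInf_mem hne

/-- If there are a key and a finger, the minimum `LF k X` is attained by a tree and a strategy. -/
theorem LF_attained {n m k : ℕ} (hn : 0 < n) (hk : 0 < k) (X : Fin m → Fin n) :
    ∃ (T : BinaryTree (Fin n)) (f : Fin m → Fin k) (ℓ : Fin k → Fin n),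
      IsBST T ∧ LF k X = strategyCost T X f ℓ := by
  obtain ⟨T₀, hT₀⟩ := exists_isBST n
  have hne : {c : ℕ | ∃ T : BinaryTree (Fin n), IsBST T ∧ c = LFTree k T X}.Nonempty :=
    ⟨_, T₀, hT₀, rfl⟩
  obtain ⟨T, hT, hc⟩ := Nat.sInf_mem hne
  have hne' : {c : ℕ | ∃ (f : Fin m → Fin k) (ℓ : Fin k → Fin n),
      c = strategyCost T X f ℓ}.Nonempty :=
    ⟨_, fun _ => ⟨0, hk⟩, fun _ => ⟨0, hn⟩, rfl⟩
  obtain ⟨f, ℓ, h⟩ := Nat.sInf_mem hne'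
  exact ⟨T, f, ℓ, hT, hc.trans h⟩

theorem treeGraph_reachable_root {α : Type} (T : BinaryTree α) :
    ∀ a, rootKey T = some a → ∀ x ∈ inorder T, (treeGraph T).Reachable a x := by
  induction T with
  | nil => intro a h; simp [rootKey] at h
  | node b l r ihl ihr =>
    intro a h x hx
    obtain rfl : b = a := by simpa [rootKey] using h
    have key : ∀ s : BinaryTree α, (∀ c, rootKey s = some c → IsChild (.node b l r) b c) →
        (∀ p c, IsChild s p c → IsChild (.node b l r) p c) →
        (∀ c, rootKey s = some c → ∀ y ∈ inorder s, (treeGraph s).Reachable c y) →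
        x ∈ inorder s → (treeGraph (.node b l r)).Reachable b x := by
      intro s h1 h2 ih hxs
      have hle : treeGraph s ≤ treeGraph (.node b l r) := by
        intro p c hpc
        simp only [treeGraph, SimpleGraph.fromRel_adj] at hpc ⊢
        exact ⟨hpc.1, hpc.2.imp (h2 _ _) (h2 _ _)⟩
      cases s with
      | nil => simp [inorder] at hxs
      | node d s₁ s₂ =>
        have h3 := (ih d rfl x hxs).mono hle
        by_cases hbd : b = d
        · exact hbd ▸ h3
        · refine SimpleGraph.Reachable.trans (SimpleGraph.Adj.reachable ?_) h3
          simp only [treeGraph, SimpleGraph.fromRel_adj]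
          exact ⟨hbd, Or.inl (h1 d rfl)⟩
    simp only [inorder, List.mem_append, List.mem_cons] at hx
    rcases hx with hx | rfl | hx
    · exact key l (fun c hc => Or.inl ⟨rfl, Or.inl hc⟩) (fun p c h => Or.inr (Or.inl h)) ihl hx
    · exact SimpleGraph.Reachable.refl _
    · exact key r (fun c hc => Or.inl ⟨rfl, Or.inr hc⟩) (fun p c h => Or.inr (Or.inr h)) ihr hx

/-- In a BST on `[n]` any two keys are joined by a path, so that `treeDist` is a true distance. -/
theorem treeGraph_preconnected {n : ℕ} {T : BinaryTree (Fin n)} (hT : IsBST T) :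
    (treeGraph T).Preconnected := by
  intro x y
  have hmem : ∀ z : Fin n, z ∈ inorder T := fun z => by
    rw [show inorder T = List.finRange n from hT]; exact List.mem_finRange z
  cases T with
  | nil => exact absurd (hmem x) (by simp [inorder])
  | node a l r =>
    exact (treeGraph_reachable_root _ a rfl x (hmem x)).symm.trans
      (treeGraph_reachable_root _ a rfl y (hmem y))

end DynBST

namespace DynBST

/-! ### Composing reconfigurations -/

/-! Let the `k` fingers move on the reference tree in unit steps, and cut time into phases of `k`
steps. In one phase they visit a set `V` of at most `2k` keys. It is enough to choose for each phase
a set of touched keys containing `V`, of size `O(k log k)` on average, so that the resulting points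
in the key-time plane are arborally satisfied. Such a family becomes an execution: the tree is kept
heap-ordered by the time of the next touch, so the keys of the current phase form its top part.
Rebuilding that part costs time linear in its size, and it is balanced during the phase, so an
access costs the logarithm of its size. Satisfaction is exactly what makes the next heap order
reachable by changing the top part alone (`exists_phase`, `OPT_le_of_satisfied`).

The touched keys are `V`, its branching keys, and some keys on the tendons, the paths of the
reference tree between neighbouring pivots. Touching whole tendons is too expensive, and touching
none of their keys leaves empty rectangles. The keys of a tendon from which it continues to the left
form a chain that carries a ruler function `g`: between two equal values there is a larger one.
Touched are the maximum of `g` on the tendon and the records met from either end, up to and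
including the first above `H`, where `H` bounds `g` on `V`. That is at most `2H + 5` keys per
tendon. Right chains are treated symmetrically with a second ruler.

For satisfaction (`EmptyRect.false`), suppose that `x`, touched first, and its left ancestor `y`,
touched last, span an empty rectangle. Then the chain from `y` to `x` lies on one tendon throughout,
since fingers reach a key only along edges. Consider where `g` is largest on this chain. Wherever
that is, some untouched key must be beaten by a key `e` farther along the tendon. If a finger visits
`e`, then `H` is at least `g e` in that phase and a key of the chain becomes a forbidden record; if
none does, `e` stays on the tendon until the other corner is touched and contradicts that.

Finally, the ruler is the 2-adic valuation of the depth in the chain plus a shift `r`. Averaged over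
`r`, its maximum on `2k` keys is `O(log k)` (`sum_maxRuler_le`), and averaging the bound on `OPT`
over `r` gives the theorem. -/

theorem Steps.trans {α : Type} {i j : ℕ} {x y z : Cursor α} (h : Steps i x y)
    (h' : Steps j y z) : Steps (i + j) x z := by
  induction h' with
  | refl => exact h
  | tail _ hs ih => exact (ih h).tail hs

/-- At most `j` unit-cost operations lead from `x` to `y`. -/
def Within {α : Type} (j : ℕ) (x y : Cursor α) : Prop := ∃ i ≤ j, Steps i x y

theorem Within.refl {α : Type} {j : ℕ} (x : Cursor α) : Within j x x :=
  ⟨0, Nat.zero_le _, .refl x⟩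

theorem Within.of_step {α : Type} {x y : Cursor α} (h : Step x y) : Within 1 x y :=
  ⟨1, le_rfl, (Steps.refl x).tail h⟩

theorem Within.trans {α : Type} {i j : ℕ} {x y z : Cursor α} (h : Within i x y)
    (h' : Within j y z) : Within (i + j) x z := by
  obtain ⟨a, ha, hs⟩ := h
  obtain ⟨b, hb, hs'⟩ := h'
  exact ⟨a + b, by omega, hs.trans hs'⟩

theorem Within.mono {α : Type} {i j : ℕ} {x y : Cursor α} (h : Within i x y) (hij : i ≤ j) :
    Within j x y := by
  obtain ⟨a, ha, hs⟩ := h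
  exact ⟨a, ha.trans hij, hs⟩

/-! ### The top part of a tree, relative to a set of keys -/

section Top

variable {α : Type} [DecidableEq α]

/-- The keys of the part of a tree that is reached from the root through keys in `Z` only. -/
def tops (Z : Finset α) : BinaryTree α → List α
  | .nil => []
  | .node a l r => if a ∈ Z then tops Z l ++ a :: tops Z r else []

/-- The subtrees that hang below the top part of a tree, from left to right. -/
def hangs (Z : Finset α) : BinaryTree α → List (BinaryTree α)
  | .nil => [.nil]
  | .node a l r => if a ∈ Z then hangs Z l ++ hangs Z r else [.node a l r]

/-- The number of keys of the top part outside of its right spine. -/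
def offSpine (Z : Finset α) : BinaryTree α → ℕ
  | .nil => 0
  | .node a l r => if a ∈ Z then (tops Z l).length + offSpine Z r else 0

/-- The tree with right spine `as` and left subtrees `hs`. -/
def vine : List α → List (BinaryTree α) → BinaryTree α
  | a :: as, h :: hs => .node a h (vine as hs)
  | _, h :: _ => h
  | _, [] => .nil

theorem length_hangs (Z : Finset α) (t : BinaryTree α) :
    (hangs Z t).length = (tops Z t).length + 1 := by
  induction t with
  | nil => simp [hangs, tops]
  | node a l r ihl ihr =>
    by_cases ha : a ∈ Z
    · simp [hangs, tops, ha, ihl, ihr]; omega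
    · simp [hangs, tops, ha]

theorem offSpine_le (Z : Finset α) (t : BinaryTree α) : offSpine Z t ≤ (tops Z t).length := by
  induction t with
  | nil => simp [offSpine]
  | node a l r ihl ihr =>
    by_cases ha : a ∈ Z
    · simp [offSpine, tops, ha]; omega
    · simp [offSpine, ha]

theorem exists_vine_eq_node (Z : Finset α) (a : α) (l r : BinaryTree α) (ha : a ∈ Z) :
    ∃ b l' r', vine (tops Z (.node a l r)) (hangs Z (.node a l r)) = .node b l' r' := by
  have h1 : tops Z (.node a l r) ≠ [] := by simp [tops, ha]
  have h2 := length_hangs Z (.node a l r)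
  obtain ⟨b, as, hb⟩ := List.exists_cons_of_ne_nil h1
  have h3 : hangs Z (.node a l r) ≠ [] := by
    intro h; rw [h] at h2; simp at h2
  obtain ⟨h, hs, hh⟩ := List.exists_cons_of_ne_nil h3
  exact ⟨b, h, vine as hs, by rw [hb, hh]; rfl⟩

/-- The right vine is a normal form of the top part. If the left child of the root belongs to the
top part, descending to it and rotating lowers `offSpine` by one; otherwise one descends to the
right subtree, with one top key fewer, and climbs back afterwards. Either way two operations are
spent per unit of the potential, and both can be undone at the same price. -/
theorem within_vine (Z : Finset α) : ∀ (N : ℕ) (t : BinaryTree α) (c : Context α),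
    (tops Z t).length + offSpine Z t = N →
    Within (2 * N) ⟨t, c⟩ ⟨vine (tops Z t) (hangs Z t), c⟩ ∧
      Within (2 * N) ⟨vine (tops Z t) (hangs Z t), c⟩ ⟨t, c⟩ := by
  intro N
  induction N using Nat.strong_induction_on with
  | _ N ih =>
  intro t c hN
  cases t with
  | nil => exact ⟨.refl _, .refl _⟩
  | node a l r =>
    by_cases ha : a ∈ Z
    swap
    · simp only [tops, hangs, ha, if_false, vine]
      exact ⟨.refl _, .refl _⟩
    have right_case : tops Z l = [] → hangs Z l = [l] →
        Within (2 * N) ⟨.node a l r, c⟩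
            ⟨vine (tops Z (.node a l r)) (hangs Z (.node a l r)), c⟩ ∧
          Within (2 * N) ⟨vine (tops Z (.node a l r)) (hangs Z (.node a l r)), c⟩
            ⟨.node a l r, c⟩ := by
      intro hl hl'
      have hv : vine (tops Z (.node a l r)) (hangs Z (.node a l r)) =
          .node a l (vine (tops Z r) (hangs Z r)) := by
        simp [tops, hangs, ha, hl, hl', vine]
      rw [hv]
      simp only [tops, offSpine, ha, if_true, hl, List.nil_append, List.length_cons,
        List.length_nil, zero_add] at hN
      cases r with
      | nil => exact ⟨.refl _, .refl _⟩
      | node b r₁ r₂ =>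
        by_cases hb : b ∈ Z
        swap
        · simp only [tops, hangs, hb, if_false, vine]
          exact ⟨.refl _, .refl _⟩
        obtain ⟨h1, h2⟩ := ih _ (by omega) (.node b r₁ r₂) (.right a l c) rfl
        obtain ⟨b', l', r', hb'⟩ := exists_vine_eq_node Z b r₁ r₂ hb
        refine ⟨(((Within.of_step (.moveRight a b l r₁ r₂ c)).trans h1).trans
          (.of_step (.moveUpFromRight a _ l c))).mono (by omega), ?_⟩
        refine Within.mono (i := 1 + _ + 1) ((Within.trans ?_ h2).trans
          (.of_step (.moveUpFromRight a _ l c))) (by omega)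
        rw [hb']
        exact .of_step (.moveRight a b' l l' r' c)
    cases l with
    | nil => exact right_case rfl rfl
    | node b l₁ l₂ =>
      by_cases hb : b ∈ Z
      swap
      · exact right_case (by simp [tops, hb]) (by simp [hangs, hb])
      have ht : tops Z (.node a (.node b l₁ l₂) r) = tops Z (.node b l₁ (.node a l₂ r)) := by
        simp [tops, ha, hb]
      have hh : hangs Z (.node a (.node b l₁ l₂) r) = hangs Z (.node b l₁ (.node a l₂ r)) := by
        simp [hangs, ha, hb]
      have hM : (tops Z (.node b l₁ (.node a l₂ r))).length +
          offSpine Z (.node b l₁ (.node a l₂ r)) + 1 = N := by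
        rw [← hN]
        simp [tops, offSpine, ha, hb]
        omega
      obtain ⟨h1, h2⟩ := ih _ (by omega) (.node b l₁ (.node a l₂ r)) c rfl
      rw [ht, hh]
      exact ⟨(((Within.of_step (.moveLeft a b l₁ l₂ r c)).trans
          (.of_step (.rotateRight a b l₁ l₂ r c))).trans h1).mono (by omega),
        ((h2.trans (.of_step (.moveRight b a l₁ l₂ r c))).trans
          (.of_step (.rotateLeft b a l₁ l₂ r c))).mono (by omega)⟩

/-- Trees that differ in the shape of the top part only are turned into one another at a cost
linear in the size of that part. -/
theorem within_of_tops_eq (Z : Finset α) {t t' : BinaryTree α} (h : tops Z t = tops Z t')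
    (h' : hangs Z t = hangs Z t') :
    Within (8 * (tops Z t).length) (Cursor.atRoot t) (Cursor.atRoot t') := by
  have h1 := (within_vine Z _ t .top rfl).1
  have h2 := (within_vine Z _ t' .top rfl).2
  rw [← h, ← h'] at h2
  -- Each potential is at most twice the number of top keys, so the way to the vine and the way back
  -- cost at most four operations per key each.
  have h3 := offSpine_le Z t
  have h4 := offSpine_le Z t'
  rw [← h] at h4
  exact (h1.trans h2).mono (by omega)

theorem inorder_vine (Z : Finset α) (t : BinaryTree α) :
    inorder (vine (tops Z t) (hangs Z t)) = inorder t := by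
  obtain ⟨i, -, hs⟩ := (within_vine Z _ t .top rfl).1
  have key : ∀ {j : ℕ} {y z : Cursor α}, Steps j y z → inorder z.tree = inorder y.tree := by
    intro j y z hyz
    induction hyz with
    | refl => rfl
    | tail _ h ih => exact h.inorder_tree.trans ih
  exact key hs

theorem tops_subset (Z : Finset α) (t : BinaryTree α) : ∀ a ∈ tops Z t, a ∈ Z := by
  induction t with
  | nil => simp [tops]
  | node a l r ihl ihr =>
    by_cases ha : a ∈ Z
    · simp only [tops, ha, if_true, List.mem_append, List.mem_cons]
      rintro x (hx | rfl | hx)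
      exacts [ihl x hx, ha, ihr x hx]
    · simp [tops, ha]

/-- The root of `t`, if any, lies outside of `Z`. -/
def RootOff (Z : Finset α) (t : BinaryTree α) : Prop := tops Z t = [] ∧ hangs Z t = [t]

theorem rootOff_of_mem_hangs (Z : Finset α) (t : BinaryTree α) :
    ∀ h ∈ hangs Z t, RootOff Z h := by
  induction t with
  | nil => simp [hangs, RootOff, tops]
  | node a l r ihl ihr =>
    by_cases ha : a ∈ Z
    · simp only [hangs, ha, if_true, List.mem_append]
      rintro x (hx | hx)
      exacts [ihl x hx, ihr x hx]
    · simp [hangs, RootOff, tops, ha]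

theorem inorder_eq_of_tops_eq (Z : Finset α) {t t' : BinaryTree α} (h : tops Z t = tops Z t')
    (h' : hangs Z t = hangs Z t') : inorder t = inorder t' := by
  rw [← inorder_vine Z t, ← inorder_vine Z t', h, h']

theorem mem_inorder_of_mem_tops (Z : Finset α) (t : BinaryTree α) :
    ∀ a ∈ tops Z t, a ∈ inorder t := by
  induction t with
  | nil => simp [tops]
  | node b l r ihl ihr =>
    by_cases hb : b ∈ Z
    · simp only [tops, hb, if_true, List.mem_append, List.mem_cons, inorder]
      rintro a (ha | ha | ha)
      exacts [.inl (ihl a ha), .inr (.inl ha), .inr (.inr (ihr a ha))]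
    · simp [tops, hb]

/-- In a tree with root `a`, no descendant has smaller priority, and so on recursively. -/
def Heap {α : Type} (p : α → ℕ) : BinaryTree α → Prop
  | .nil => True
  | .node a l r => (∀ y ∈ inorder l, p a ≤ p y) ∧ (∀ y ∈ inorder r, p a ≤ p y) ∧
      Heap p l ∧ Heap p r

/-- Every key of `as` has at most the priority of the keys in the two trees of `hs` next to it. -/
def AdjacentLE {α : Type} (p : α → ℕ) : List α → List (BinaryTree α) → Prop
  | a :: as, h :: hs => (∀ y ∈ inorder h, p a ≤ p y) ∧
      (∀ h' ∈ hs.head?, ∀ y ∈ inorder h', p a ≤ p y) ∧ AdjacentLE p as hs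
  | _, _ => True

/-- Insert a key `a`, with left subtree `h`, to the left of the top part of a tree. -/
def insertLeft (Z : Finset α) (p : α → ℕ) (a : α) (h : BinaryTree α) :
    BinaryTree α → BinaryTree α
  | .nil => .node a h .nil
  | .node b l r => if b ∈ Z ∧ p b ≤ p a then .node b (insertLeft Z p a h l) r
      else .node a h (.node b l r)

theorem tops_insertLeft (Z : Finset α) (p : α → ℕ) (a : α) (h : BinaryTree α) (ha : a ∈ Z)
    (hh : RootOff Z h) (t : BinaryTree α) :
    tops Z (insertLeft Z p a h t) = a :: tops Z t ∧
      hangs Z (insertLeft Z p a h t) = h :: hangs Z t := by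
  induction t with
  | nil => simp [insertLeft, tops, hangs, ha, hh.1, hh.2]
  | node b l r ihl ihr =>
    by_cases hb : b ∈ Z ∧ p b ≤ p a
    · simp [insertLeft, hb, tops, hangs, ihl.1, ihl.2]
    · rw [insertLeft, if_neg hb]
      simp [tops, hangs, ha, hh.1, hh.2]

theorem inorder_insertLeft (Z : Finset α) (p : α → ℕ) (a : α) (h : BinaryTree α)
    (t : BinaryTree α) :
    inorder (insertLeft Z p a h t) = inorder h ++ a :: inorder t := by
  induction t with
  | nil => simp [insertLeft, inorder]
  | node b l r ihl ihr =>
    by_cases hb : b ∈ Z ∧ p b ≤ p a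
    · simp [insertLeft, hb, inorder, ihl]
    · rw [insertLeft, if_neg hb]
      simp [inorder]

/-- The new key precedes the whole tree in symmetric order, so its neighbours are `h` and the
leftmost hanging subtree. It sinks along the left spine below top keys of no larger priority. Where
it stops, heap order controls everything beneath it, unless that place is the leftmost hanging
subtree itself, which `hat` covers. -/
theorem heap_insertLeft (Z : Finset α) (p : α → ℕ) (a : α) (h : BinaryTree α) (t : BinaryTree α)
    (hh : Heap p h) (hah : ∀ y ∈ inorder h, p a ≤ p y) (ht : Heap p t)
    (hat : ∀ h' ∈ (hangs Z t).head?, ∀ y ∈ inorder h', p a ≤ p y) :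
    Heap p (insertLeft Z p a h t) := by
  induction t with
  | nil => exact ⟨hah, by simp [inorder], hh, trivial⟩
  | node b l r ihl ihr =>
    by_cases hb : b ∈ Z ∧ p b ≤ p a
    · rw [insertLeft, if_pos hb]
      have hl : hangs Z l ≠ [] := by
        intro h0; have := length_hangs Z l; rw [h0] at this; simp at this
      refine ⟨?_, ht.2.1, ihl ht.2.2.1 ?_, ht.2.2.2⟩
      · intro y hy
        rw [inorder_insertLeft, List.mem_append, List.mem_cons] at hy
        rcases hy with hy | rfl | hy
        exacts [hb.2.trans (hah y hy), hb.2, ht.1 y hy]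
      · intro h' hh'
        refine hat h' ?_
        rw [hangs, if_pos hb.1, List.head?_append_of_ne_nil _ hl]
        exact hh'
    · rw [insertLeft, if_neg hb]
      refine ⟨hah, ?_, hh, ht⟩
      by_cases hbZ : b ∈ Z
      · have hab : p a ≤ p b := by
          by_contra hc
          exact hb ⟨hbZ, by omega⟩
        intro y hy
        simp only [inorder, List.mem_append, List.mem_cons] at hy
        rcases hy with hy | rfl | hy
        exacts [hab.trans (ht.1 y hy), hab, hab.trans (ht.2.1 y hy)]
      · exact hat _ (by simp [hangs, hbZ])

/-- A heap-ordered top part with prescribed keys and hanging subtrees. -/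
theorem exists_heap (Z : Finset α) (p : α → ℕ) : ∀ (as : List α) (hs : List (BinaryTree α)),
    hs.length = as.length + 1 → (∀ a ∈ as, a ∈ Z) → (∀ h ∈ hs, RootOff Z h) →
    (∀ h ∈ hs, Heap p h) → AdjacentLE p as hs →
    ∃ t, tops Z t = as ∧ hangs Z t = hs ∧ Heap p t := by
  intro as
  induction as with
  | nil =>
    intro hs hlen _ hoff hheap _
    obtain ⟨h, rfl⟩ := List.length_eq_one_iff.1 hlen
    exact ⟨h, (hoff h (by simp)).1, (hoff h (by simp)).2, hheap h (by simp)⟩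
  | cons a as ih =>
    intro hs hlen hZ hoff hheap hadj
    cases hs with
    | nil => simp at hlen
    | cons h hs =>
      obtain ⟨t, h1, h2, h3⟩ := ih hs (by simpa using hlen) (fun x hx => hZ x (by simp [hx]))
        (fun x hx => hoff x (by simp [hx])) (fun x hx => hheap x (by simp [hx])) hadj.2.2
      have h4 := tops_insertLeft Z p a h (hZ a (by simp)) (hoff h (by simp)) t
      exact ⟨insertLeft Z p a h t, by rw [h4.1, h1], by rw [h4.2, h2],
        heap_insertLeft Z p a h t (hheap h (by simp)) hadj.1 h3 (by rw [h2]; exact hadj.2.1)⟩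

theorem heap_of_mem_hangs (Z : Finset α) (p : α → ℕ) (t : BinaryTree α) (ht : Heap p t) :
    ∀ h ∈ hangs Z t, Heap p h := by
  induction t with
  | nil => simp [hangs, Heap]
  | node a l r ihl ihr =>
    by_cases ha : a ∈ Z
    · simp only [hangs, ha, if_true, List.mem_append]
      rintro h (hh | hh)
      exacts [ihl ht.2.2.1 h hh, ihr ht.2.2.2 h hh]
    · simp only [hangs, ha, if_false, List.mem_singleton]
      rintro h rfl
      exact ht

/-- The root of a hanging subtree lies outside of `Z`, so its priority exceeds `b`, and by heap
order so do all priorities beneath it. Thus the top part contains all of `Z`. -/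
theorem not_mem_of_mem_hangs (Z : Finset α) (p : α → ℕ) (b : ℕ) (hp : ∀ a, p a ≤ b ↔ a ∈ Z)
    (t : BinaryTree α) (ht : Heap p t) : ∀ h ∈ hangs Z t, ∀ y ∈ inorder h, y ∉ Z := by
  intro h hh y hy
  have h1 := heap_of_mem_hangs Z p t ht h hh
  have h2 := rootOff_of_mem_hangs Z t h hh
  cases h with
  | nil => simp [inorder] at hy
  | node c l r =>
    have hc : c ∉ Z := by
      intro hc
      have := h2.1
      simp [tops, hc] at this
    rw [← hp] at hc ⊢
    simp only [inorder, List.mem_append, List.mem_cons] at hy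
    rcases hy with hy | rfl | hy
    · have := h1.1 y hy; omega
    · exact hc
    · have := h1.2.1 y hy; omega

end Top

theorem Heap.congr {α : Type} {p p' : α → ℕ} (t : BinaryTree α) (h : ∀ y ∈ inorder t, p y = p' y)
    (ht : Heap p t) : Heap p' t := by
  induction t with
  | nil => trivial
  | node a l r ihl ihr =>
    simp only [inorder, List.mem_append, List.mem_cons] at h
    have ha := h a (by simp)
    refine ⟨fun y hy => ?_, fun y hy => ?_, ihl (fun y hy => h y (.inl hy)) ht.2.2.1,
      ihr (fun y hy => h y (.inr (.inr hy))) ht.2.2.2⟩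
    · rw [← ha, ← h y (.inl hy)]; exact ht.1 y hy
    · rw [← ha, ← h y (.inr (.inr hy))]; exact ht.2.1 y hy

/-- A top part of small height with prescribed keys and hanging subtrees. -/
theorem exists_balanced {n : ℕ} (Z : Finset (Fin n)) : ∀ (d : ℕ) (as : List (Fin n))
    (hs : List (BinaryTree (Fin n))),
    as.length < 2 ^ d → hs.length = as.length + 1 → (∀ a ∈ as, a ∈ Z) →
    (∀ h ∈ hs, RootOff Z h) → ∃ t, tops Z t = as ∧ hangs Z t = hs ∧
      ((inorder t).Pairwise (· < ·) → ∀ x ∈ as, searchCost t x ≤ d) := by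
  intro d
  induction d with
  | zero =>
    intro as hs has hlen _ hoff
    obtain rfl : as = [] := by simpa using has
    obtain ⟨h, rfl⟩ := List.length_eq_one_iff.1 hlen
    exact ⟨h, (hoff h (by simp)).1, (hoff h (by simp)).2, by simp⟩
  | succ d ih =>
    intro as hs has hlen hZ hoff
    by_cases has0 : as = []
    · subst has0
      obtain ⟨h, rfl⟩ := List.length_eq_one_iff.1 hlen
      exact ⟨h, (hoff h (by simp)).1, (hoff h (by simp)).2, by simp⟩
    have hpos : 0 < as.length := List.length_pos_iff.2 has0
    set q := as.length / 2 with hq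
    have hqlt : q < as.length := by omega
    have hsplit : as = as.take q ++ as[q] :: as.drop (q + 1) := by
      rw [List.cons_getElem_drop_succ, List.take_append_drop]
    have hsplit' : hs = hs.take (q + 1) ++ hs.drop (q + 1) := by
      rw [List.take_append_drop]
    rw [pow_succ] at has
    obtain ⟨t₁, h11, h12, h13⟩ := ih (as.take q) (hs.take (q + 1))
      (by rw [List.length_take]; omega) (by rw [List.length_take, List.length_take]; omega)
      (fun a ha => hZ a (List.mem_of_mem_take ha)) (fun a ha => hoff a (List.mem_of_mem_take ha))
    obtain ⟨t₂, h21, h22, h23⟩ := ih (as.drop (q + 1)) (hs.drop (q + 1))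
      (by rw [List.length_drop]; omega) (by rw [List.length_drop, List.length_drop]; omega)
      (fun a ha => hZ a (List.mem_of_mem_drop ha)) (fun a ha => hoff a (List.mem_of_mem_drop ha))
    have hqZ : as[q] ∈ Z := hZ _ (List.getElem_mem _)
    refine ⟨.node as[q] t₁ t₂, ?_, ?_, ?_⟩
    · rw [tops, if_pos hqZ, h11, h21, ← hsplit]
    · rw [hangs, if_pos hqZ, h12, h22, ← hsplit']
    · intro hsort x hx
      rw [inorder, List.pairwise_append, List.pairwise_cons] at hsort
      obtain ⟨hs1, ⟨hs2, hs3⟩, hs4⟩ := hsort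
      rw [hsplit, List.mem_append, List.mem_cons] at hx
      rcases hx with hx | hx | hx
      · have hlt : x < as[q] := hs4 x (mem_inorder_of_mem_tops Z t₁ x (by rw [h11]; exact hx)) _
          (by simp)
        have := h13 hs1 x hx
        rw [searchCost, if_pos hlt]; omega
      · rw [hx, searchCost]; simp
      · have hlt : as[q] < x := hs2 x (mem_inorder_of_mem_tops Z t₂ x (by rw [h21]; exact hx))
        have := h23 hs3 x hx
        rw [searchCost, if_neg hlt.not_gt, if_pos hlt]; omega

/-! ### From satisfied families of key sets to executions -/

/-- The first time from `b` on at which the key `u` is touched. -/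
noncomputable def nextTouch {α : Type} (Z : ℕ → Finset α) (b : ℕ) (u : α) : ℕ :=
  sInf {c | b ≤ c ∧ u ∈ Z c}

/-- Arboral satisfaction: a rectangle spanned by two touched points that share neither the key
nor the time contains a third touched point. -/
def Satisfied {α : Type} [LinearOrder α] (Z : ℕ → Finset α) : Prop :=
  ∀ s t x y, s < t → x ∈ Z s → y ∈ Z t → x ≠ y →
    ∃ c z, s ≤ c ∧ c ≤ t ∧ z ∈ Z c ∧ (x ≤ z ∧ z ≤ y ∨ y ≤ z ∧ z ≤ x) ∧
      ¬(z = x ∧ c = s) ∧ ¬(z = y ∧ c = t)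

/-! ### Next-touch times as heap priorities -/

section NextTouch

variable {α : Type} {Z : ℕ → Finset α}

theorem le_nextTouch (hZ : ∀ b u, ∃ c, b ≤ c ∧ u ∈ Z c) (b : ℕ) (u : α) :
    b ≤ nextTouch Z b u := (Nat.sInf_mem (hZ b u)).1

theorem mem_nextTouch (hZ : ∀ b u, ∃ c, b ≤ c ∧ u ∈ Z c) (b : ℕ) (u : α) :
    u ∈ Z (nextTouch Z b u) := (Nat.sInf_mem (hZ b u)).2

theorem nextTouch_le {b c : ℕ} {u : α} (hb : b ≤ c) (hu : u ∈ Z c) : nextTouch Z b u ≤ c :=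
  Nat.sInf_le ⟨hb, hu⟩

theorem nextTouch_le_iff (hZ : ∀ b u, ∃ c, b ≤ c ∧ u ∈ Z c) (b : ℕ) (u : α) :
    nextTouch Z b u ≤ b ↔ u ∈ Z b := by
  refine ⟨fun h => ?_, fun h => nextTouch_le le_rfl h⟩
  have h1 := mem_nextTouch hZ b u
  rwa [le_antisymm h (le_nextTouch hZ b u)] at h1

theorem nextTouch_succ (hZ : ∀ b u, ∃ c, b ≤ c ∧ u ∈ Z c) {b : ℕ} {u : α} (hu : u ∉ Z b) :
    nextTouch Z (b + 1) u = nextTouch Z b u := by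
  apply le_antisymm
  · refine nextTouch_le ?_ (mem_nextTouch hZ b u)
    have := le_nextTouch hZ b u
    rw [← nextTouch_le_iff hZ] at hu
    omega
  · exact nextTouch_le ((Nat.le_succ b).trans (le_nextTouch hZ _ u)) (mem_nextTouch hZ _ u)

/-- Apply satisfaction to the rectangle from `a` at time `b` to `y` at its next touch. By `hgap` the
third point comes after `b`. If its key is `a`, the claim follows; otherwise its key is strictly
closer to `a` and is touched no later than `y`, and induction on the size of the interval applies.
-/
theorem nextTouch_le_of_satisfied [LinearOrder α] [Finite α]
    (hZ : ∀ b u, ∃ c, b ≤ c ∧ u ∈ Z c) (hsat : Satisfied Z) (b : ℕ) (a : α)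
    (ha : a ∈ Z b) (y : α) (hy : y ≠ a)
    (hgap : ∀ z, z ≠ a → (a ≤ z ∧ z ≤ y ∨ y ≤ z ∧ z ≤ a) → z ∉ Z b) :
    nextTouch Z (b + 1) a ≤ nextTouch Z (b + 1) y := by
  have key : ∀ (N : ℕ) (y : α), Set.ncard (Set.uIcc a y) = N → y ≠ a →
      (∀ z, z ≠ a → (a ≤ z ∧ z ≤ y ∨ y ≤ z ∧ z ≤ a) → z ∉ Z b) →
      nextTouch Z (b + 1) a ≤ nextTouch Z (b + 1) y := by
    intro N
    induction N using Nat.strong_induction_on with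
    | _ N ih =>
    intro y hN hy hgap
    have hlt : b < nextTouch Z (b + 1) y := le_nextTouch hZ (b + 1) y
    obtain ⟨c, z, hbc, hct, hzc, hz, hn1, hn2⟩ := hsat b _ a y hlt ha (mem_nextTouch hZ _ y)
      (Ne.symm hy)
    by_cases hza : z = a
    · subst hza
      have hcb : c ≠ b := fun h => hn1 ⟨rfl, h⟩
      exact (nextTouch_le (by omega) hzc).trans hct
    · have hcb : c ≠ b := fun h => hgap z hza hz (h ▸ hzc)
      have hzle : nextTouch Z (b + 1) z ≤ c := nextTouch_le (by omega) hzc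
      have hzy : z ≠ y := by
        rintro rfl
        exact hn2 ⟨rfl, le_antisymm hct hzle⟩
      have hsub : Set.uIcc a z ⊆ Set.uIcc a y := by
        intro w hw
        rw [Set.mem_uIcc] at hw ⊢
        rcases hz with ⟨h1, h2⟩ | ⟨h1, h2⟩ <;> rcases hw with ⟨h3, h4⟩ | ⟨h3, h4⟩
        · exact .inl ⟨h3, h4.trans h2⟩
        · exact .inl ⟨h1.trans h3, h4.trans (h1.trans h2)⟩
        · exact .inr ⟨(h1.trans h2).trans h3, h4.trans h2⟩
        · exact .inr ⟨h1.trans h3, h4⟩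
      have hyn : y ∉ Set.uIcc a z := by
        intro hw
        rw [Set.mem_uIcc] at hw
        rcases hz with ⟨h1, h2⟩ | ⟨h1, h2⟩ <;> rcases hw with ⟨h3, h4⟩ | ⟨h3, h4⟩
        · exact hzy (le_antisymm h2 h4)
        · exact hza (le_antisymm (h2.trans h4) h1)
        · exact hza (le_antisymm h2 (h3.trans h1))
        · exact hzy (le_antisymm h3 h1)
      have hcard : Set.ncard (Set.uIcc a z) < N := by
        rw [← hN]
        refine Set.ncard_lt_ncard ⟨hsub, fun h => hyn (h Set.right_mem_uIcc)⟩ (Set.toFinite _)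
      refine (ih _ hcard z rfl hza ?_).trans (hzle.trans hct)
      intro w hwa hw
      have hw' : w ∈ Set.uIcc a y := hsub (Set.mem_uIcc.2 (by
        rcases hw with hw | hw
        · exact .inl hw
        · exact .inr hw))
      exact hgap w hwa (Set.mem_uIcc.1 hw')
  exact key _ y rfl hy hgap

end NextTouch

/-- All keys between a spine key and a key of a hanging subtree next to it lie in that subtree or
are the spine key itself, so no other key in between is touched at time `b` and
`nextTouch_le_of_satisfied` applies. Closure under larger keys, unlike containing every key, is
inherited by the tail of the vine. -/
theorem adjacentLE_of_satisfied {n : ℕ} {Z : ℕ → Finset (Fin n)}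
    (hZ : ∀ b u, ∃ c, b ≤ c ∧ u ∈ Z c) (hsat : Satisfied Z) (b : ℕ) :
    ∀ (as : List (Fin n)) (hs : List (BinaryTree (Fin n))), hs.length = as.length + 1 →
      (inorder (vine as hs)).Pairwise (· < ·) →
      (∀ z ∈ inorder (vine as hs), ∀ w, z ≤ w → w ∈ inorder (vine as hs)) →
      (∀ a ∈ as, a ∈ Z b) → (∀ h ∈ hs, ∀ y ∈ inorder h, y ∉ Z b) →
      AdjacentLE (nextTouch Z (b + 1)) as hs := by
  intro as
  induction as with
  | nil => intro hs _ _ _ _ _; trivial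
  | cons a as ih =>
    intro hs hlen hsort hup haZ hhs
    cases hs with
    | nil => simp at hlen
    | cons h hs =>
      have hsort' := hsort
      simp only [vine, inorder] at hsort hup
      rw [List.pairwise_append, List.pairwise_cons] at hsort
      obtain ⟨hs1, ⟨hs2, hs3⟩, hs4⟩ := hsort
      simp only [List.mem_append, List.mem_cons] at hup hs4
      refine ⟨fun y hy => ?_, fun h' hh' y hy => ?_, ih hs (by simpa using hlen) hs3 ?_
        (fun x hx => haZ x (by simp [hx])) (fun x hx => hhs x (by simp [hx]))⟩
      · have hya : y < a := hs4 y hy a (.inl rfl)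
        refine nextTouch_le_of_satisfied hZ hsat b a (haZ a (by simp)) y hya.ne ?_
        rintro z hza (⟨h1, h2⟩ | ⟨h1, h2⟩)
        · exact absurd (h1.trans h2) hya.not_ge
        · rcases hup y (.inl hy) z h1 with hz | hz | hz
          · exact hhs h (by simp) z hz
          · exact absurd hz hza
          · exact absurd (hs2 z hz) h2.not_gt
      · have hmem : h' ∈ hs := List.mem_of_mem_head? hh'
        cases hs with
        | nil => simp at hmem
        | cons h'' hs' =>
          obtain rfl : h'' = h' := by simpa using hh'
          have hsplit : ∀ z, z ∈ inorder (vine as (h'' :: hs')) → z ∈ inorder h'' ∨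
              ∀ w ∈ inorder h'', w < z := by
            intro z hz
            cases as with
            | nil => exact .inl hz
            | cons a' as' =>
              simp only [vine, inorder] at hs3 hz
              rw [List.pairwise_append] at hs3
              rw [List.mem_append] at hz
              rcases hz with hz | hz
              · exact .inl hz
              · exact .inr fun w hw => hs3.2.2 w hw z hz
          have hyv : y ∈ inorder (vine as (h'' :: hs')) := by
            cases as with
            | nil => exact hy
            | cons a' as' => simp only [vine, inorder, List.mem_append]; exact .inl hy
          have hay : a < y := hs2 y hyv
          refine nextTouch_le_of_satisfied hZ hsat b a (haZ a (by simp)) y hay.ne' ?_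
          rintro z hza (⟨h1, h2⟩ | ⟨h1, h2⟩)
          · rcases hup a (.inr (.inl rfl)) z h1 with hz | hz | hz
            · exact absurd (hs4 z hz a (.inl rfl)) h1.not_gt
            · exact absurd hz hza
            · rcases hsplit z hz with hz' | hz'
              · exact hhs _ (by simp) z hz'
              · exact absurd (hz' y hy) h2.not_gt
          · exact absurd (h1.trans h2) hay.not_ge
      · intro z hz w hzw
        have haz := hs2 z hz
        rcases hup z (.inr (.inr hz)) w hzw with hw | hw | hw
        · exact absurd (hs4 w hw a (.inl rfl)) (haz.trans_le hzw).not_gt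
        · exact absurd (haz.trans_le hzw) (by rw [hw]; exact lt_irrefl a)
        · exact hw

/-- One phase: a tree in which the keys touched now are balanced on top, and its successor. -/
theorem exists_phase {n : ℕ} {Z : ℕ → Finset (Fin n)}
    (hZ : ∀ b u, ∃ c, b ≤ c ∧ u ∈ Z c) (hsat : Satisfied Z) (d : ℕ → ℕ) (b : ℕ)
    (t : BinaryTree (Fin n)) (ht : IsBST t) (hheap : Heap (nextTouch Z b) t) :
    ∃ t', (IsBST t' ∧ Heap (nextTouch Z (b + 1)) t') ∧ ∃ u, IsBST u ∧
      Within (8 * (Z b).card) (Cursor.atRoot t) (Cursor.atRoot u) ∧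
      Within (8 * (Z b).card) (Cursor.atRoot u) (Cursor.atRoot t') ∧
      ((Z b).card < 2 ^ d b → ∀ x ∈ Z b, searchCost u x ≤ d b) := by
  have hbst : inorder t = List.finRange n := ht
  have hsorted : (inorder t).Pairwise (· < ·) := by
    rw [hbst]; exact List.pairwise_lt_finRange n
  have hlen := length_hangs (Z b) t
  have htops := tops_subset (Z b) t
  have hoff := rootOff_of_mem_hangs (Z b) t
  have hnot := not_mem_of_mem_hangs (Z b) _ b (nextTouch_le_iff hZ b) t hheap
  have hadj : AdjacentLE (nextTouch Z (b + 1)) (tops (Z b) t) (hangs (Z b) t) := by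
    refine adjacentLE_of_satisfied hZ hsat b _ _ hlen ?_ ?_ htops hnot
    · rw [inorder_vine]; exact hsorted
    · rw [inorder_vine, hbst]
      exact fun z _ w _ => List.mem_finRange w
  -- The hanging subtrees can be kept as they are: none of their keys is touched at time `b`, so
  -- their next-touch times do not change.
  obtain ⟨t', h1, h2, h3⟩ := exists_heap (Z b) (nextTouch Z (b + 1)) _ _ hlen htops hoff
    (fun h hh => (heap_of_mem_hangs (Z b) _ t hheap h hh).congr _
      fun y hy => (nextTouch_succ hZ (hnot h hh y hy)).symm) hadj
  have hmemtops : ∀ x ∈ Z b, x ∈ tops (Z b) t := by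
    intro x hx
    have hxt : x ∈ inorder (vine (tops (Z b) t) (hangs (Z b) t)) := by
      rw [inorder_vine, hbst]; exact List.mem_finRange x
    have key : ∀ (as : List (Fin n)) (hs : List (BinaryTree (Fin n))),
        x ∈ inorder (vine as hs) → x ∈ as ∨ ∃ h ∈ hs, x ∈ inorder h := by
      intro as
      induction as with
      | nil =>
        intro hs h
        cases hs with
        | nil => simp [vine, inorder] at h
        | cons h' hs => exact .inr ⟨h', by simp, h⟩
      | cons a as ih =>
        intro hs h
        cases hs with
        | nil => simp [vine, inorder] at h
        | cons h' hs =>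
          simp only [vine, inorder, List.mem_append, List.mem_cons] at h
          rcases h with h | h | h
          · exact .inr ⟨h', by simp, h⟩
          · exact .inl (by simp [h])
          · rcases ih hs h with h | ⟨h'', h1, h2⟩
            · exact .inl (by simp [h])
            · exact .inr ⟨h'', by simp [h1], h2⟩
    rcases key _ _ hxt with h | ⟨h, hh, hxh⟩
    · exact h
    · exact absurd hx (hnot h hh x hxh)
  have hnodup : (tops (Z b) t).Nodup := by
    have key : ∀ t : BinaryTree (Fin n), (tops (Z b) t).Sublist (inorder t) := by
      intro t
      induction t with
      | nil => simp [tops, inorder]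
      | node a l r ihl ihr =>
        by_cases ha : a ∈ Z b
        · simp only [tops, ha, if_true, inorder]
          exact ihl.append (ihr.cons_cons a)
        · simp [tops, ha]
    exact (key t).nodup (hbst ▸ List.nodup_finRange n)
  have hcard : (tops (Z b) t).length ≤ (Z b).card := by
    rw [← List.toFinset_card_of_nodup hnodup]
    exact Finset.card_le_card fun x hx => htops x (List.mem_toFinset.1 hx)
  have ht' : IsBST t' :=
    (inorder_eq_of_tops_eq (Z b) h1 h2).trans hbst
  by_cases hd : (Z b).card < 2 ^ d b
  · obtain ⟨u, hu1, hu2, hu3⟩ := exists_balanced (Z b) (d b) _ _ (hcard.trans_lt hd) hlen htops hoff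
    have hu : IsBST u := (inorder_eq_of_tops_eq (Z b) hu1 hu2).trans hbst
    refine ⟨t', ⟨ht', h3⟩, u, hu, ?_, ?_, fun _ x hx => hu3 ?_ x (hmemtops x hx)⟩
    · exact (within_of_tops_eq (Z b) hu1.symm hu2.symm).mono (by omega)
    · exact (within_of_tops_eq (Z b) (hu1.trans h1.symm) (hu2.trans h2.symm)).mono
        (by rw [hu1]; omega)
    · rw [show inorder u = _ from hu]; exact List.pairwise_lt_finRange n
  · refine ⟨t', ⟨ht', h3⟩, t, ht, .refl _, ?_, fun h => absurd h hd⟩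
    exact (within_of_tops_eq (Z b) h1.symm h2.symm).mono (by omega)

/-! ### Chaining the phases into one execution -/

theorem exists_seq_of_step {β : Type} {Q : ℕ → β → Prop} {R : ℕ → β → β → Prop}
    (h0 : ∃ t, Q 0 t) (hs : ∀ b t, Q b t → ∃ t', Q (b + 1) t' ∧ R b t t') :
    ∃ f : ℕ → β, ∀ b, R b (f b) (f (b + 1)) := by
  choose! g hg using hs
  obtain ⟨t, ht⟩ := h0
  let f : ℕ → β := fun b => Nat.rec t (fun b x => g b x) b
  have hf : ∀ b, Q b (f b) := by
    intro b
    induction b with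
    | zero => exact ht
    | succ b ih => exact (hg b _ ih).1
  exact ⟨f, fun b => (hg b _ (hf b)).2⟩

theorem exists_heap_isBST {n : ℕ} (p : Fin n → ℕ) : ∃ t, IsBST t ∧ Heap p t := by
  have hadj : ∀ as : List (Fin n), AdjacentLE p as (List.replicate (as.length + 1) .nil) := by
    intro as
    induction as with
    | nil => trivial
    | cons a as ih =>
      refine ⟨by simp [inorder], ?_, ih⟩
      intro h' hh'
      have := List.mem_of_mem_head? hh'
      rw [List.mem_replicate] at this
      rw [this.2]; simp [inorder]
  have hvine : ∀ as : List (Fin n),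
      inorder (vine as (List.replicate (as.length + 1) .nil)) = as := by
    intro as
    induction as with
    | nil => rfl
    | cons a as ih => simpa [vine, inorder, List.replicate_succ] using ih
  obtain ⟨t, h1, h2, h3⟩ := exists_heap Finset.univ p (List.finRange n)
    (List.replicate ((List.finRange n).length + 1) .nil) (by simp) (by simp)
    (fun h hh => by rw [(List.mem_replicate.1 hh).2]; exact ⟨rfl, rfl⟩)
    (fun h hh => by rw [(List.mem_replicate.1 hh).2]; trivial) (hadj _)
  refine ⟨t, ?_, h3⟩
  have := inorder_vine Finset.univ t
  rw [h1, h2, hvine] at this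
  exact this.symm

/-- A satisfied family of key sets is turned into an execution: the keys in `Z b` are balanced on
top of the tree during phase `b`. -/
theorem OPT_le_of_satisfied {n m : ℕ} (X : Fin m → Fin n) {Z : ℕ → Finset (Fin n)}
    (hZ : ∀ b u, ∃ c, b ≤ c ∧ u ∈ Z c) (hsat : Satisfied Z) (d : ℕ → ℕ) (β : Fin m → ℕ)
    (hβ : Monotone β) (B : ℕ) (hB : ∀ t, β t ≤ B) (hX : ∀ t, X t ∈ Z (β t))
    (hd : ∀ b ≤ B, (Z b).card < 2 ^ d b) :
    OPT X ≤ ∑ t, d (β t) + ∑ c ∈ Finset.range B, 8 * ((Z c).card + (Z (c + 1)).card) := by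
  obtain ⟨f, hf⟩ := exists_seq_of_step
    (Q := fun b t => IsBST t ∧ Heap (nextTouch Z b) t) (exists_heap_isBST _)
    (fun b t h => exists_phase hZ hsat d b t h.1 h.2)
  choose u hu0 hu1 hu2 hu3 using hf
  -- The way from `u c` to `u (c + 1)` leads through the heap-ordered tree at the start of phase `c
  -- + 1`, which is why both sizes are paid; `F` is the running total.
  set F : ℕ → ℕ := fun x => ∑ c ∈ Finset.range x, 8 * ((Z c).card + (Z (c + 1)).card) with hF
  have hFmono : Monotone F := fun a b hab =>
    Finset.sum_le_sum_of_subset (Finset.range_mono hab)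
  have hstep : ∀ b i, Within (F (b + i) - F b) (Cursor.atRoot (u b)) (Cursor.atRoot (u (b + i))) := by
    intro b i
    induction i with
    | zero => exact .refl _
    | succ i ih =>
      have h1 := (ih.trans (hu2 (b + i))).trans (hu1 (b + i + 1))
      refine h1.mono ?_
      have h2 : F (b + (i + 1)) = F (b + i) + 8 * ((Z (b + i)).card + (Z (b + i + 1)).card) := by
        rw [hF, ← add_assoc]; exact Finset.sum_range_succ _ _
      have h3 := hFmono (show b ≤ b + i by omega)
      omega
  -- Access `i` takes place in the balanced tree of its phase. The tree after the last access is
  -- that of phase `B`, so the reconfiguration bounds telescope to `F B`.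
  let γ : ℕ → ℕ := fun i => if h : i < m then β ⟨i, h⟩ else B
  have hγ : Monotone γ := by
    intro i j hij
    by_cases hj : j < m
    · have hi : i < m := by omega
      simp only [γ, hi, hj, dif_pos]
      exact hβ (by simpa using hij)
    · by_cases hi : i < m
      · simp only [γ, hi, hj, dif_pos]
        simpa using hB _
      · simp [γ, hi, hj]
  have hr : ∀ i, ∃ r ≤ F (γ (i + 1)) - F (γ i),
      Steps r (Cursor.atRoot (u (γ i))) (Cursor.atRoot (u (γ (i + 1)))) := by
    intro i
    have h1 := hstep (γ i) (γ (i + 1) - γ i)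
    rwa [Nat.add_sub_cancel' (hγ (Nat.le_succ i))] at h1
  choose r hr1 hr2 using hr
  have hexec : IsExecution (fun i : Fin (m + 1) => u (γ i)) (fun i : Fin m => r i) :=
    ⟨hu0 _, fun t => ⟨_, hr2 t, rfl⟩⟩
  have hopt : OPT X ≤ executionCost X (fun i : Fin (m + 1) => u (γ i)) (fun i : Fin m => r i) :=
    Nat.sInf_le ⟨_, _, hexec, rfl⟩
  refine hopt.trans ?_
  rw [executionCost, Finset.sum_add_distrib]
  refine Nat.add_le_add (Finset.sum_le_sum fun t _ => ?_) ?_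
  · have h1 : γ t = β t := by simp [γ]
    simp only [Fin.val_castSucc, h1]
    exact hu3 _ (hd _ (hB t)) _ (hX t)
  · rw [Fin.sum_univ_eq_sum_range (fun i => r i)]
    refine (Finset.sum_le_sum fun i _ => hr1 i).trans ?_
    rw [Finset.sum_range_tsub (f := fun i => F (γ i)) (hFmono.comp hγ)]
    have : γ m = B := by simp [γ]
    rw [this]
    exact Nat.sub_le _ _

/-! ### Search orders -/

/-- The order on the keys of a binary search tree, with the relations `L u w` (`w` lies in the left
subtree of `u`) and `R u w` (`w` lies in the right subtree of `u`). -/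
structure SearchOrder (α : Type) where
  lt : α → α → Prop
  L : α → α → Prop
  R : α → α → Prop
  lt_irrefl : ∀ x, ¬lt x x
  lt_trans : ∀ {x y z}, lt x y → lt y z → lt x z
  lt_tri : ∀ x y, lt x y ∨ x = y ∨ lt y x
  L_lt : ∀ {u w}, L u w → lt w u
  R_lt : ∀ {u w}, R u w → lt u w
  L_L : ∀ {u w z}, L u w → L w z → L u z
  L_R : ∀ {u w z}, L u w → R w z → L u z
  R_L : ∀ {u w z}, R u w → L w z → R u z
  R_R : ∀ {u w z}, R u w → R w z → R u z
  lca : ∀ {x y}, lt x y → L y x ∨ R x y ∨ ∃ a, L a x ∧ R a y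

namespace SearchOrder

variable {α : Type} (S : SearchOrder α)

/-- The mirror image. -/
def dual : SearchOrder α where
  lt x y := S.lt y x
  L := S.R
  R := S.L
  lt_irrefl := S.lt_irrefl
  lt_trans h h' := S.lt_trans h' h
  lt_tri x y := by
    rcases S.lt_tri x y with h | h | h
    exacts [.inr (.inr h), .inr (.inl h), .inl h]
  L_lt := S.R_lt
  R_lt := S.L_lt
  L_L := S.R_R
  L_R := S.R_L
  R_L := S.L_R
  R_R := S.L_L
  lca h := by
    rcases S.lca h with h | h | ⟨a, h1, h2⟩
    exacts [.inr (.inl h), .inl h, .inr (.inr ⟨a, h2, h1⟩)]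

/-- `w` lies in the subtree of `u`. -/
def Sub (u w : α) : Prop := u = w ∨ S.L u w ∨ S.R u w

variable {S}

theorem Sub.refl (u : α) : S.Sub u u := .inl rfl

theorem L_sub {u w z : α} (h : S.L u w) (h' : S.Sub w z) : S.L u z := by
  rcases h' with rfl | h' | h'
  exacts [h, S.L_L h h', S.L_R h h']

theorem R_sub {u w z : α} (h : S.R u w) (h' : S.Sub w z) : S.R u z := by
  rcases h' with rfl | h' | h'
  exacts [h, S.R_L h h', S.R_R h h']

theorem L.sub {u w : α} (h : S.L u w) : S.Sub u w := .inr (.inl h)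

theorem R.sub {u w : α} (h : S.R u w) : S.Sub u w := .inr (.inr h)

theorem Sub.trans {u w z : α} (h : S.Sub u w) (h' : S.Sub w z) : S.Sub u z := by
  rcases h with rfl | h | h
  exacts [h', (L_sub h h').sub, (R_sub h h').sub]

theorem L_irrefl (u : α) : ¬S.L u u := fun h => S.lt_irrefl _ (S.L_lt h)

theorem L_asymm {u w : α} (h : S.L u w) : ¬S.L w u := fun h' => L_irrefl _ (S.L_L h h')

theorem L_not_R {u w : α} (h : S.L u w) : ¬S.R u w :=
  fun h' => S.lt_irrefl _ (S.lt_trans (S.L_lt h) (S.R_lt h'))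

/-- Ancestors of `z` are nested, and neither can lie in the right subtree of the other or be
separated from it, since `z` is to the left of both. So the left ancestors of a key form a chain. -/
theorem L_comparable {u w z : α} (hu : S.L u z) (hw : S.L w z) : u = w ∨ S.L u w ∨ S.L w u := by
  have key : ∀ {u w : α}, S.L u z → S.L w z → S.lt u w → S.L w u := by
    intro u w hu hw hlt
    rcases S.lca hlt with h | h | ⟨a, h1, h2⟩
    · exact h
    · exact absurd (S.R_L h hw) (L_not_R hu)
    · exact absurd (S.R_L h2 hw) (L_not_R (S.L_L h1 hu))
  rcases S.lt_tri u w with h | h | h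
  exacts [.inr (.inr (key hu hw h)), .inl h, .inr (.inl (key hw hu h))]

theorem exists_lowest [Finite α] {y : α} {Q : α → Prop} (h : ∃ e, S.L e y ∧ Q e) :
    ∃ e, S.L e y ∧ Q e ∧ ∀ w, S.L e w → S.L w y → ¬Q w := by
  have : IsTrans α (fun a b => S.L b a) := ⟨fun a b c h h' => S.L_L h' h⟩
  have : Std.Irrefl (fun a b => S.L b a) := ⟨fun a => L_irrefl a⟩
  have wf := Finite.wellFounded_of_trans_of_irrefl (fun a b => S.L b a)
  obtain ⟨e, ⟨h1, h2⟩, h3⟩ := wf.has_min {e | S.L e y ∧ Q e} h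
  exact ⟨e, h1, h2, fun w hw hwy hQ => h3 w ⟨hwy, hQ⟩ hw⟩

theorem exists_highest [Finite α] {x : α} {Q : α → Prop} (h : ∃ e, S.L x e ∧ Q e) :
    ∃ e, S.L x e ∧ Q e ∧ ∀ w, S.L x w → S.L w e → ¬Q w := by
  have : IsTrans α (fun a b => S.L a b) := ⟨fun a b c h h' => S.L_L h h'⟩
  have : Std.Irrefl (fun a b => S.L a b) := ⟨fun a => L_irrefl a⟩
  have wf := Finite.wellFounded_of_trans_of_irrefl (fun a b => S.L a b)
  obtain ⟨e, ⟨h1, h2⟩, h3⟩ := wf.has_min {e | S.L x e ∧ Q e} h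
  exact ⟨e, h1, h2, fun w hw hwy hQ => h3 w ⟨hw, hQ⟩ hwy⟩

/-- A ruler function on left chains: between two keys of a chain with equal value there is one of
larger value. -/
def IsRuler (S : SearchOrder α) (g : α → ℕ) : Prop :=
  ∀ u w, S.L u w → g u = g w → ∃ z, S.L u z ∧ S.L z w ∧ g u < g z

/-- Two points sharing the maximal value would have a larger value between them, inside the set by
convexity. -/
theorem IsRuler.exists_max [Finite α] {g : α → ℕ} (hg : S.IsRuler g) {K : Set α}
    (hne : K.Nonempty) (hchain : ∀ a ∈ K, ∀ b ∈ K, a = b ∨ S.L a b ∨ S.L b a)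
    (hconv : ∀ a ∈ K, ∀ b ∈ K, ∀ c, S.L a c → S.L c b → c ∈ K) :
    ∃ u ∈ K, ∀ z ∈ K, z ≠ u → g z < g u := by
  obtain ⟨u, hu, hmax⟩ := Set.exists_max_image K g K.toFinite hne
  refine ⟨u, hu, fun z hz hzu => lt_of_le_of_ne (hmax z hz) fun heq => ?_⟩
  rcases hchain z hz u hu with h | h | h
  · exact hzu h
  · obtain ⟨c, h1, h2, h3⟩ := hg z u h heq
    have := hmax c (hconv z hz u hu c h1 h2)
    omega
  · obtain ⟨c, h1, h2, h3⟩ := hg u z h heq.symm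
    have := hmax c (hconv u hu z hz c h1 h2)
    omega

/-! ### Touched keys -/

variable (S)

/-- There are keys of `V` in both subtrees of `u`. -/
def Branching (V : Finset α) (u : α) : Prop := (∃ v ∈ V, S.L u v) ∧ ∃ v ∈ V, S.R u v

/-- A pivot is a key in `V` or a branching key. -/
def Pivot (V : Finset α) (u : α) : Prop := u ∈ V ∨ S.Branching V u

/-- The keys of `V` below `u` exist and lie in the left subtree of `u`. -/
def AllLeft (V : Finset α) (u : α) : Prop := (∃ v ∈ V, S.Sub u v) ∧ ∀ v ∈ V, S.Sub u v → S.L u v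

/-- The keys of `V` below `u` lie in the left subtree of `w`. -/
def Tendon (V : Finset α) (u w : α) : Prop := ∀ v ∈ V, S.Sub u v → S.L w v

/-- The value of `g` at `u` exceeds the values at the keys below `u` on the same tendon, and these
are at most `H`. -/
def RecordBelow (V : Finset α) (g : α → ℕ) (H : ℕ) (u : α) : Prop :=
  S.AllLeft V u ∧ ∀ w, S.L u w → S.Tendon V u w → g w < g u ∧ g w ≤ H

/-- The value of `g` at `u` exceeds the values at the keys above `u` on the same tendon, and these
are at most `H`. -/
def RecordAbove (V : Finset α) (g : α → ℕ) (H : ℕ) (u : α) : Prop :=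
  S.AllLeft V u ∧ ∀ w, S.L w u → S.Tendon V w u → g w < g u ∧ g w ≤ H

/-- `u` is the maximum of `g` on the keys with the same elements of `V` below them. -/
def Top (V : Finset α) (g : α → ℕ) (u : α) : Prop :=
  S.AllLeft V u ∧ ∀ w, (S.L w u ∧ S.Tendon V w u) ∨ (S.L u w ∧ S.Tendon V u w) → g w < g u

/-- The keys touched on left chains. -/
def ChainTouched (V : Finset α) (g : α → ℕ) (H : ℕ) (u : α) : Prop :=
  S.RecordBelow V g H u ∨ S.RecordAbove V g H u ∨ S.Top V g u

/-- The keys touched in a phase in which the fingers visit `V`. -/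
def Touched (V : Finset α) (g l : α → ℕ) (H : ℕ) (u : α) : Prop :=
  S.Pivot V u ∨ S.ChainTouched V g H u ∨ S.dual.ChainTouched V l H u

/-- Every key of `V` has a partner in `V ∩ V'` on the same side of each key outside of `V`. -/
def Link (V V' : Finset α) : Prop :=
  ∀ v ∈ V, ∃ v' ∈ V, v' ∈ V' ∧ ∀ u ∉ V, (S.L u v ↔ S.L u v') ∧ (S.R u v ↔ S.R u v')

variable {S} {V V' : Finset α} {g l : α → ℕ} {H : ℕ}

theorem dual_sub {u w : α} : S.dual.Sub u w ↔ S.Sub u w := by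
  simp only [Sub, dual]
  tauto

theorem dual_branching {u : α} : S.dual.Branching V u ↔ S.Branching V u := by
  simp only [Branching, dual]
  tauto

theorem dual_pivot {u : α} : S.dual.Pivot V u ↔ S.Pivot V u := by
  simp only [Pivot, dual_branching]

theorem dual_touched {u : α} : S.dual.Touched V l g H u ↔ S.Touched V g l H u := by
  simp only [Touched, dual_pivot, show S.dual.dual = S from rfl]
  tauto

theorem Link.dual (h : S.Link V V') : S.dual.Link V V' := by
  intro v hv
  obtain ⟨v', h1, h2, h3⟩ := h v hv
  exact ⟨v', h1, h2, fun u hu => (h3 u hu).symm⟩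

theorem Pivot.exists_sub {u : α} (h : S.Pivot V u) : ∃ v ∈ V, S.Sub u v := by
  rcases h with h | ⟨⟨v, hv, h⟩, -⟩
  exacts [⟨u, h, .refl u⟩, ⟨v, hv, h.sub⟩]

theorem ChainTouched.exists_L {u : α} (h : S.ChainTouched V g H u) : ∃ v ∈ V, S.L u v := by
  rcases h with ⟨⟨⟨v, hv, h⟩, h'⟩, -⟩ | ⟨⟨⟨v, hv, h⟩, h'⟩, -⟩ | ⟨⟨⟨v, hv, h⟩, h'⟩, -⟩ <;>
    exact ⟨v, hv, h' v hv h⟩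

theorem Touched.exists_sub {u : α} (h : S.Touched V g l H u) : ∃ v ∈ V, S.Sub u v := by
  rcases h with h | h | h
  · exact h.exists_sub
  · obtain ⟨v, hv, h⟩ := h.exists_L
    exact ⟨v, hv, h.sub⟩
  · obtain ⟨v, hv, h⟩ := h.exists_L
    exact ⟨v, hv, dual_sub.1 h.sub⟩

theorem AllLeft.chainTouched {u : α} (hu : S.AllLeft V u) (h : S.Touched V g l H u) :
    S.ChainTouched V g H u := by
  rcases h with (h | ⟨-, v, hv, h⟩) | h | h
  · exact absurd (hu.2 u h (.refl u)) (L_irrefl u)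
  · exact absurd h (L_not_R (hu.2 v hv h.sub))
  · exact h
  · obtain ⟨v, hv, h⟩ := h.exists_L
    exact absurd h (L_not_R (hu.2 v hv (R.sub h)))

theorem Tendon.not_mem {u w : α} (h : S.Tendon V u w) (huw : S.L u w) : u ∉ V ∧ w ∉ V :=
  ⟨fun hu => L_asymm huw (h u hu (.refl u)), fun hw => L_irrefl w (h w hw huw.sub)⟩

theorem Tendon.upper {u w z : α} (h : S.Tendon V u w) (huz : S.L u z) : S.Tendon V z w :=
  fun v hv hzv => h v hv (huz.sub.trans hzv)

theorem Tendon.lower {u w z : α} (h : S.Tendon V u w) (hzw : S.L z w) : S.Tendon V u z :=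
  fun v hv huv => S.L_L hzw (h v hv huv)

theorem Tendon.trans {u w z : α} (h : S.Tendon V u w) (h' : S.Tendon V w z) : S.Tendon V u z :=
  fun v hv huv => h' v hv (h v hv huv).sub

/-- A branching key separates two keys of `V`. Both lie to the left of `w`, hence so does the
branching key: no pivot interrupts a tendon. -/
theorem Tendon.pivot {u w q : α} (h : S.Tendon V u w) (hq : S.Pivot V q) (huq : S.Sub u q) :
    S.L w q := by
  rcases hq with hq | ⟨⟨v, hv, hqv⟩, ⟨v', hv', hqv'⟩⟩
  · exact h q hq huq
  · have h1 := h v hv (huq.trans hqv.sub)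
    have h2 := h v' hv' (huq.trans hqv'.sub)
    rcases L_comparable h1 hqv with rfl | h3 | h3
    · exact absurd hqv' (L_not_R h2)
    · exact h3
    · exact absurd hqv' (L_not_R (S.L_L h3 h2))

theorem allLeft_of_not_pivot {u v : α} (h : ¬S.Pivot V u) (hv : v ∈ V) (huv : S.L u v) :
    S.AllLeft V u := by
  refine ⟨⟨v, hv, huv.sub⟩, ?_⟩
  rintro w hw (rfl | h' | h')
  · exact absurd (.inl hw) h
  · exact h'
  · exact absurd (.inr ⟨⟨v, hv, huv⟩, ⟨w, hw, h'⟩⟩) h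

/-- Each key of `V'` has a partner in `V` on the same side of `u` and of `w`. So a tendon persists
from phase to phase as long as its two ends are not visited. -/
theorem Link.tendon (h : S.Link V' V) {u w : α} (hu : u ∉ V') (hw : w ∉ V')
    (ht : S.Tendon V u w) : S.Tendon V' u w := by
  intro v hv huv
  obtain ⟨v', h1, h2, h3⟩ := h v hv
  have huv' : S.Sub u v' := by
    rcases huv with rfl | huv | huv
    · exact absurd hv hu
    · exact ((h3 u hu).1.1 huv).sub
    · exact ((h3 u hu).2.1 huv).sub
  exact (h3 w hw).1.2 (ht v' h2 huv')

/-! ### Empty rectangles do not exist -/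

/-- A rectangle with corners `x` at time `0` and `y` at time `D`, where `x` lies in the left subtree
of `y`, that contains no other touched point. -/
structure EmptyRect (S : SearchOrder α) (g l : α → ℕ) (V : ℕ → Finset α) (H : ℕ → ℕ) (D : ℕ)
    (x y : α) : Prop where
  ruler : S.IsRuler g
  level : ∀ b ≤ D, ∀ v ∈ V b, g v ≤ H b
  fwd : ∀ b < D, S.Link (V b) (V (b + 1))
  bwd : ∀ b < D, S.Link (V (b + 1)) (V b)
  left : S.L y x
  pos : 1 ≤ D
  touched_x : S.Touched (V 0) g l (H 0) x
  touched_y : S.Touched (V D) g l (H D) y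
  empty : ∀ b ≤ D, ∀ z, (z = x ∨ S.lt x z) → (z = y ∨ S.lt z y) →
    S.Touched (V b) g l (H b) z → (z = x ∧ b = 0) ∨ (z = y ∧ b = D)

namespace EmptyRect

variable {V : ℕ → Finset α} {H : ℕ → ℕ} {D : ℕ} {x y : α}

theorem not_touched_x (E : EmptyRect S g l V H D x y) {b : ℕ} (hb : b ≤ D) (hb' : b ≠ 0) :
    ¬S.Touched (V b) g l (H b) x := by
  intro h
  rcases E.empty b hb x (.inl rfl) (.inr (S.L_lt E.left)) h with ⟨-, h⟩ | ⟨h, -⟩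
  · exact hb' h
  · exact L_irrefl _ (h ▸ E.left)

theorem not_touched (E : EmptyRect S g l V H D x y) {b : ℕ} {z : α} (hb : b ≤ D)
    (hzx : S.L z x) (hyz : z = y ∨ S.L y z) (h' : z ≠ y ∨ b ≠ D) :
    ¬S.Touched (V b) g l (H b) z := by
  intro h
  rcases E.empty b hb z (.inr (S.L_lt hzx)) (hyz.imp_right S.L_lt) h with ⟨h, -⟩ | ⟨h, h''⟩
  · exact L_irrefl _ (h ▸ hzx)
  · exact h'.elim (fun k => k h) (fun k => k h'')

/-- At time `0` a visit to `x` would end the tendon there: the lowest key of the chain strictly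
above `x` would have no key below it on its tendon, hence be a vacuous record from below. At later
times a visit to `x` is a touch inside the rectangle. -/
theorem x_not_mem [Finite α] (E : EmptyRect S g l V H D x y) {b : ℕ} (hb : b ≤ D) : x ∉ V b := by
  intro hx
  by_cases hb0 : b = 0
  swap
  · exact E.not_touched_x hb hb0 (.inl (.inl hx))
  subst hb0
  obtain ⟨z, hzx, hz, hlow⟩ := exists_lowest (S := S) (y := x) (Q := fun z => z = y ∨ S.L y z)
    ⟨y, E.left, .inl rfl⟩
  have hn := E.not_touched hb hzx hz (.inr (by have := E.pos; omega))
  refine hn (.inr (.inl (.inl ⟨allLeft_of_not_pivot (fun h => hn (.inl h)) hx hzx,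
    fun w hzw ht => absurd ?_ (hlow w hzw (ht x hx hzx.sub))⟩)))
  rcases hz with rfl | hz
  exacts [.inr hzw, .inr (S.L_L hz hzw)]

theorem not_R (E : EmptyRect S g l V H D x y) {b : ℕ} (hb : b ≤ D) {v : α} (hv : v ∈ V b) :
    ¬S.R x v := by
  intro h
  have hyv : S.L y v := L_sub E.left h.sub
  rcases E.empty b hb v (.inr (S.R_lt h)) (.inr (S.L_lt hyv)) (.inl (.inl hv)) with ⟨h', -⟩ | ⟨h', -⟩
  · exact S.lt_irrefl _ (h' ▸ S.R_lt h)
  · exact L_irrefl _ (h' ▸ hyv)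

/-- Since `x` is never visited, the links carry a visited key in its left subtree from each phase to
the next. -/
theorem exists_L [Finite α] (E : EmptyRect S g l V H D x y) {b : ℕ} (hb : b ≤ D) :
    ∃ v ∈ V b, S.L x v := by
  induction b with
  | zero =>
    obtain ⟨v, hv, h⟩ := E.touched_x.exists_sub
    rcases h with rfl | h | h
    exacts [absurd hv (E.x_not_mem hb), ⟨v, hv, h⟩, absurd h (E.not_R hb hv)]
  | succ b ih =>
    obtain ⟨v, hv, h⟩ := ih (by omega)
    obtain ⟨v', -, h2, h3⟩ := E.fwd b (by omega) v hv
    exact ⟨v', h2, (h3 x (E.x_not_mem (by omega))).1.1 h⟩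

theorem allLeft_x [Finite α] (E : EmptyRect S g l V H D x y) {b : ℕ} (hb : b ≤ D) :
    S.AllLeft (V b) x := by
  obtain ⟨v, hv, h⟩ := E.exists_L hb
  refine ⟨⟨v, hv, h.sub⟩, ?_⟩
  rintro w hw (rfl | h | h)
  exacts [absurd hw (E.x_not_mem hb), h, absurd h (E.not_R hb hw)]

theorem allLeft [Finite α] (E : EmptyRect S g l V H D x y) {b : ℕ} {z : α} (hb : b ≤ D)
    (hzx : S.L z x) (hyz : z = y ∨ S.L y z) (h' : z ≠ y ∨ b ≠ D) : S.AllLeft (V b) z := by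
  have hn := E.not_touched hb hzx hyz h'
  obtain ⟨v, hv, h⟩ := E.exists_L hb
  exact allLeft_of_not_pivot (fun h => hn (.inl h)) hv (S.L_L hzx h)

/-- A visited key below `y` but not to the left of `x` is smaller than `x`, by emptiness. It then
yields a pivot `e` between `y` and `x` with `x` to its right. The lowest left ancestor of `e` on the
chain from `y` is a vacuous record from below, and it lies inside the rectangle. -/
theorem tendon_y [Finite α] (E : EmptyRect S g l V H D x y) {b : ℕ} (hb : b < D) :
    S.Tendon (V b) y x := by
  intro v hv hyv
  have hyv : S.L y v := (E.allLeft hb.le E.left (.inl rfl) (.inr hb.ne)).2 v hv hyv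
  by_contra hxv
  have hvx : v ≠ x := by
    rintro rfl
    exact E.x_not_mem hb.le hv
  have hlt : S.lt v x := by
    rcases S.lt_tri v x with h | h | h
    · exact h
    · exact absurd h hvx
    · rcases E.empty b hb.le v (.inr h) (.inr (S.L_lt hyv)) (.inl (.inl hv)) with
        ⟨h', -⟩ | ⟨-, h'⟩
      exacts [absurd h' hvx, absurd h' hb.ne]
  obtain ⟨v', hv', hxv'⟩ := E.exists_L hb.le
  obtain ⟨e, hev, hex, hpe⟩ : ∃ e, (e = v ∨ S.L e v) ∧ S.R e x ∧ S.Pivot (V b) e := by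
    rcases S.lca hlt with h | h | ⟨a, h1, h2⟩
    · exact absurd h hxv
    · exact ⟨v, .inl rfl, h, .inl hv⟩
    · exact ⟨a, .inr h1, h2, .inr ⟨⟨v, hv, h1⟩, ⟨v', hv', S.R_L h2 hxv'⟩⟩⟩
  have hye : S.L y e := by
    rcases S.lca (S.lt_trans (S.R_lt hex) (S.L_lt E.left)) with h | h | ⟨a, h1, h2⟩
    · exact h
    · exfalso
      rcases hev with rfl | hev
      · exact S.lt_irrefl _ (S.R_lt (R_sub h hyv.sub))
      · exact L_not_R hev (R_sub h hyv.sub)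
    · exact absurd (R_sub h2 E.left.sub) (L_not_R (L_sub h1 hex.sub))
  obtain ⟨z, hze, hz, hlow⟩ := exists_lowest (S := S) (y := e) (Q := fun z => z = y ∨ S.L y z)
    ⟨y, hye, .inl rfl⟩
  have hzx := L_sub hze hex.sub
  refine E.not_touched hb.le hzx hz (.inr hb.ne) (.inr (.inl (.inl
    ⟨E.allLeft hb.le hzx hz (.inr hb.ne),
      fun w hzw ht => absurd ?_ (hlow w hzw (ht.pivot hpe hze.sub))⟩)))
  rcases hz with rfl | hz
  exacts [.inr hzw, .inr (S.L_L hz hzw)]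

theorem tendon [Finite α] (E : EmptyRect S g l V H D x y) {b : ℕ} {z : α} (hb : b ≤ D)
    (hzx : S.L z x) (hyz : z = y ∨ S.L y z) (h' : z ≠ y ∨ b ≠ D) : S.Tendon (V b) z x := by
  have key : ∀ b < D, S.Tendon (V b) z x := by
    intro b hb
    rcases hyz with rfl | hyz
    exacts [E.tendon_y hb, (E.tendon_y hb).upper hyz]
  by_cases hbD : b = D
  · subst hbD
    obtain ⟨c, rfl⟩ : ∃ c, b = c + 1 := ⟨b - 1, by have := E.pos; omega⟩
    exact (E.bwd c (by omega)).tendon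
      (fun hz => E.not_touched hb hzx hyz h' (.inl (.inl hz))) (E.x_not_mem hb) (key c (by omega))
  · exact key b (by omega)

theorem tendon_up [Finite α] (E : EmptyRect S g l V H D x y) {e : α}
    (ht : S.Tendon (V 0) e x) (he : ∀ b, 1 ≤ b → b ≤ D → e ∉ V b) {b : ℕ} (hb : b ≤ D) :
    S.Tendon (V b) e x := by
  induction b with
  | zero => exact ht
  | succ b ih =>
    exact (E.bwd b (by omega)).tendon (he _ (by omega) hb) (E.x_not_mem hb) (ih (by omega))

theorem tendon_down [Finite α] (E : EmptyRect S g l V H D x y) {e : α}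
    (ht : S.Tendon (V D) x e) (he : ∀ b < D, e ∉ V b) :
    S.Tendon (V 0) x e := by
  have key : ∀ i ≤ D, S.Tendon (V (D - i)) x e := by
    intro i
    induction i with
    | zero => exact fun _ => ht
    | succ i ih =>
      intro hi
      have h1 := ih (by omega)
      have h2 := E.fwd (D - (i + 1)) (by omega)
      rw [show D - (i + 1) + 1 = D - i by omega] at h2
      exact h2.tendon (E.x_not_mem (by omega)) (he _ (by omega)) h1
  simpa using key D le_rfl

/-- The visited key `e` cuts the tendon, so `u` has to beat only the keys strictly between `e` and
`u`, and `g e` is below the threshold of this phase. -/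
theorem touched_of_above (E : EmptyRect S g l V H D x y) {b : ℕ} {e u : α} (hb : b ≤ D)
    (he : e ∈ V b) (heu : S.L e u) (hu : S.AllLeft (V b) u)
    (hw : ∀ w, S.L e w → S.L w u → g w < g u ∧ g w ≤ g e) : S.Touched (V b) g l (H b) u := by
  refine .inr (.inl (.inr (.inl ⟨hu, fun w hwu ht => ?_⟩)))
  have hew : S.L e w := by
    rcases L_comparable heu hwu with rfl | h | h
    · exact absurd he (ht.not_mem hwu).1
    · exact h
    · exact absurd (ht e he h.sub) (L_asymm heu)
  exact ⟨(hw w hew hwu).1, (hw w hew hwu).2.trans (E.level b hb e he)⟩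

theorem touched_of_below (E : EmptyRect S g l V H D x y) {b : ℕ} {e u : α} (hb : b ≤ D)
    (he : e ∈ V b) (heu : S.L u e) (hu : S.AllLeft (V b) u)
    (hw : ∀ w, S.L u w → S.L w e → g w < g u ∧ g w ≤ g e) : S.Touched (V b) g l (H b) u := by
  refine .inr (.inl (.inl ⟨hu, fun w huw ht => ?_⟩))
  have hwe := ht e he heu.sub
  exact ⟨(hw w huw hwe).1, (hw w huw hwe).2.trans (E.level b hb e he)⟩

theorem chainTouched_x [Finite α] (E : EmptyRect S g l V H D x y) :
    S.ChainTouched (V 0) g (H 0) x := (E.allLeft_x (Nat.zero_le D)).chainTouched E.touched_x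

theorem tendon_last [Finite α] (E : EmptyRect S g l V H D x y) (hy : y ∉ V D) :
    S.Tendon (V D) y x := by
  obtain ⟨c, rfl⟩ : ∃ c, D = c + 1 := ⟨D - 1, by have := E.pos; omega⟩
  exact (E.bwd c (by omega)).tendon hy (E.x_not_mem le_rfl) (E.tendon_y (by omega))

theorem chainTouched_y [Finite α] (E : EmptyRect S g l V H D x y) (hy : y ∉ V D) :
    S.ChainTouched (V D) g (H D) y := by
  obtain ⟨v, hv, hxv⟩ := E.exists_L le_rfl
  refine AllLeft.chainTouched ⟨⟨v, hv, (S.L_L E.left hxv).sub⟩, fun w hw hyw => ?_⟩ E.touched_y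
  exact S.L_L E.left (E.tendon_last hy w hw hyw)

/-- The maximum of `g` on the chain from `y` to `x` is not attained strictly inside. -/
theorem not_max_inside [Finite α] (E : EmptyRect S g l V H D x y) {u : α} (hux : S.L u x)
    (hyu : S.L y u) (hmax : ∀ z, (z = x ∨ S.L z x) → (z = y ∨ S.L y z) → z ≠ u → g z < g u) :
    False := by
  have hD := E.pos
  have hy_ne : y ≠ u := by rintro rfl; exact L_irrefl _ hyu
  have hx_ne : x ≠ u := by rintro rfl; exact L_irrefl _ hux
  have hyu' : u ≠ y ∨ (0 : ℕ) ≠ D := .inl hy_ne.symm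
  have hgx := hmax x (.inl rfl) (.inr E.left) hx_ne
  have hgy := hmax y (.inr E.left) (.inl rfl) hy_ne
  -- `u` is untouched, so it is not the maximum of its tendon at time `0`. A key below `x` cannot
  -- beat it: the other two rules would force `g u < g x`, so `x` would be a record from below and
  -- exceed that key. Hence a key above `y` does.
  have hex : ∃ e, S.L e y ∧ S.Tendon (V 0) e x ∧ g u ≤ g e := by
    have hn := E.not_touched (Nat.zero_le D) hux (.inr hyu) hyu'
    have hl := E.allLeft (Nat.zero_le D) hux (.inr hyu) hyu'
    have htu := E.tendon (Nat.zero_le D) hux (.inr hyu) hyu'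
    by_contra! hcon
    refine hn (.inr (.inl (.inr (.inr ⟨hl, ?_⟩))))
    rintro e (⟨heu, ht⟩ | ⟨hue, ht⟩)
    · rcases L_comparable heu hyu with rfl | h | h
      · exact hgy
      · exact hcon e h (ht.trans htu)
      · exact hmax e (.inr (S.L_L heu hux)) (.inr h) (by rintro rfl; exact L_irrefl _ heu)
    · obtain ⟨v, hv, hxv⟩ := E.exists_L (Nat.zero_le D)
      have hev : S.L e v := ht v hv (S.L_L hux hxv).sub
      rcases L_comparable hev hxv with rfl | h | h
      · exact hgx
      · exact hmax e (.inr h) (.inr (S.L_L hyu hue)) (by rintro rfl; exact L_irrefl _ hue)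
      · rcases E.chainTouched_x with h' | h' | h'
        · exact (h'.2 e h (ht.upper hux)).1.trans hgx
        · exact absurd (h'.2 u hux htu).1 (by omega)
        · exact absurd (h'.2 u (.inl ⟨hux, htu⟩)) (by omega)
  obtain ⟨e, hey, ⟨ht, hge⟩, hlow⟩ := exists_lowest hex
  have hlow' : ∀ w, S.L e w → S.L w y → g w < g u := fun w h1 h2 => by
    by_contra hc
    exact hlow w h1 h2 ⟨ht.upper h1, by omega⟩
  -- If the lowest such `e` is visited, `u` becomes a record from above in that phase. If it never
  -- is, `e` is still on the tendon at time `D`, and `y` is neither a record, from below because of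
  -- `u` or from above because of `e`, nor the maximum.
  by_cases hv : ∃ b, 1 ≤ b ∧ b ≤ D ∧ e ∈ V b
  · obtain ⟨b, hb1, hbD, heb⟩ := hv
    refine E.not_touched hbD hux (.inr hyu) (.inl hy_ne.symm)
      (E.touched_of_above hbD heb (S.L_L hey hyu)
        (E.allLeft hbD hux (.inr hyu) (.inl hy_ne.symm)) fun w hew hwu => ?_)
    have : g w < g u := by
      rcases L_comparable hwu hyu with rfl | h | h
      · exact hgy
      · exact hlow' w hew h
      · exact hmax w (.inr (S.L_L hwu hux)) (.inr h) (by rintro rfl; exact L_irrefl _ hwu)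
    exact ⟨this, by omega⟩
  · push Not at hv
    have htD := E.tendon_up ht hv le_rfl
    have hyD : y ∉ V D := fun h => L_asymm E.left (htD y h hey.sub)
    rcases E.chainTouched_y hyD with h' | h' | h'
    · have := (h'.2 u hyu ((htD.upper hey).lower hux)).1
      omega
    · have := (h'.2 e hey (htD.lower E.left)).1
      omega
    · have := h'.2 e (.inl ⟨hey, htD.lower E.left⟩)
      omega

/-- The maximum of `g` on the chain from `y` to `x` is not attained at `x`. -/
theorem not_max_x [Finite α] (E : EmptyRect S g l V H D x y)
    (hmax : ∀ z, S.L z x → (z = y ∨ S.L y z) → g z < g x) : False := by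
  have hD := E.pos
  have hgy := hmax y E.left (.inl rfl)
  -- The runner-up `w₀` is the candidate for a record from above at time `0`; its failure produces a
  -- larger value above `y`. For this its value, hence all values it has to beat, must be at most `H
  -- 0`.
  obtain ⟨w₀, ⟨hw₀x, hw₀y⟩, hw₀⟩ := E.ruler.exists_max
    (K := {z | S.L z x ∧ (z = y ∨ S.L y z)}) ⟨y, E.left, .inl rfl⟩
    (fun a ha b hb => L_comparable ha.1 hb.1)
    (fun a ha b hb c h1 h2 => ⟨S.L_L h2 hb.1, .inr (by
      rcases ha.2 with rfl | h
      exacts [h1, S.L_L h h1])⟩)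
  have hwx := hmax w₀ hw₀x hw₀y
  have hle : ∀ z, S.L z x → (z = y ∨ S.L y z) → g z ≤ g w₀ := fun z h1 h2 => by
    by_cases h : z = w₀
    · rw [h]
    · exact (hw₀ z ⟨h1, h2⟩ h).le
  have h0D : (0 : ℕ) ≠ D := by omega
  have ht0 := E.tendon (Nat.zero_le D) hw₀x hw₀y (.inr h0D)
  -- If `x` is a record from above, this is part of the rule. Otherwise `x` dominates the tendon
  -- below it at time `0`, but not at time `D`. So the key `e` that beats it then was visited before
  -- `D`, and that visit makes `x` a record from below, which is allowed at time `0` only.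
  have hH : g w₀ ≤ H 0 := by
    have below : (∀ e, S.L x e → S.Tendon (V 0) x e → g e < g x) → g w₀ ≤ H 0 := by
      intro hbel
      have hex : ∃ e, S.L x e ∧ S.Tendon (V D) x e ∧ g x ≤ g e := by
        by_contra! hcon
        refine E.not_touched_x le_rfl h0D.symm (.inr (.inl (.inr (.inr ⟨E.allLeft_x le_rfl, ?_⟩))))
        rintro e (⟨hex, ht⟩ | ⟨hxe, ht⟩)
        · rcases L_comparable hex E.left with rfl | h | h
          · exact hgy
          · have hyD : y ∉ V D := fun hy => L_asymm E.left (ht y hy h.sub)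
            rcases E.chainTouched_y hyD with h' | h' | h'
            · exact absurd (h'.2 x E.left (E.tendon_last hyD)).1 (by omega)
            · exact (h'.2 e h (ht.lower E.left)).1.trans hgy
            · exact (h'.2 e (.inl ⟨h, ht.lower E.left⟩)).trans hgy
          · exact hmax e hex (.inr h)
        · exact hcon e hxe ht
      obtain ⟨e, hxe, ⟨ht, hge⟩, hhigh⟩ := exists_highest hex
      by_cases hv : ∃ b, b < D ∧ e ∈ V b
      · obtain ⟨b, hbD, heb⟩ := hv
        have htouch := E.touched_of_below hbD.le heb hxe (E.allLeft_x hbD.le) fun w h1 h2 => by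
          have : g w < g x := by
            by_contra hc
            exact hhigh w h1 h2 ⟨ht.lower h2, by omega⟩
          exact ⟨this, by omega⟩
        obtain rfl : b = 0 := by
          by_contra hb0
          exact E.not_touched_x hbD.le hb0 htouch
        have := E.level 0 (Nat.zero_le D) e heb
        omega
      · push Not at hv
        have := hbel e hxe (E.tendon_down ht hv)
        omega
    rcases E.chainTouched_x with h | h | h
    · exact below fun e h1 h2 => (h.2 e h1 h2).1
    · exact (h.2 w₀ hw₀x ht0).2
    · exact below fun e h1 h2 => h.2 e (.inr ⟨h1, h2⟩)
  have hex : ∃ e, S.L e y ∧ S.Tendon (V 0) e x ∧ g w₀ ≤ g e := by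
    by_contra! hcon
    refine E.not_touched (Nat.zero_le D) hw₀x hw₀y (.inr h0D) (.inr (.inl (.inr (.inl
      ⟨E.allLeft (Nat.zero_le D) hw₀x hw₀y (.inr h0D), fun e he ht => ?_⟩))))
    have : g e < g w₀ := by
      have hex := S.L_L he hw₀x
      rcases L_comparable hex E.left with h | h | h
      · exact hw₀ e ⟨hex, .inl h⟩ (by rintro rfl; exact L_irrefl _ he)
      · exact hcon e h (ht.trans ht0)
      · exact hw₀ e ⟨hex, .inr h⟩ (by rintro rfl; exact L_irrefl _ he)
    exact ⟨this, by omega⟩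
  obtain ⟨e, hey, ⟨ht, hge⟩, hlow⟩ := exists_lowest hex
  by_cases hv : ∃ b, 1 ≤ b ∧ b ≤ D ∧ e ∈ V b
  · obtain ⟨b, hb1, hbD, heb⟩ := hv
    refine E.not_touched_x hbD (by omega) (E.touched_of_above hbD heb (S.L_L hey E.left)
      (E.allLeft_x hbD) fun w hew hwx' => ?_)
    have : g w ≤ g w₀ := by
      rcases L_comparable hwx' E.left with h | h | h
      · exact hle w hwx' (.inl h)
      · by_contra hc
        exact hlow w hew h ⟨ht.upper hew, by omega⟩
      · exact hle w hwx' (.inr h)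
    exact ⟨by omega, by omega⟩
  · push Not at hv
    have htD := E.tendon_up ht hv le_rfl
    have hyD : y ∉ V D := fun h => L_asymm E.left (htD y h hey.sub)
    have hyle := hle y E.left (.inl rfl)
    rcases E.chainTouched_y hyD with h' | h' | h'
    · have := (h'.2 x E.left (E.tendon_last hyD)).1
      omega
    · have := (h'.2 e hey (htD.lower E.left)).1
      omega
    · have := h'.2 e (.inl ⟨hey, htD.lower E.left⟩)
      omega

/-- The maximum of `g` on the chain from `y` to `x` is not attained at `y`. -/
theorem not_max_y [Finite α] (E : EmptyRect S g l V H D x y)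
    (hmax : ∀ z, (z = x ∨ S.L z x) → S.L y z → g z < g y) : False := by
  have hD := E.pos
  have hgx := hmax x (.inl rfl) E.left
  have h0D : (0 : ℕ) ≠ D := by omega
  have ht0 := E.tendon (Nat.zero_le D) E.left (.inl rfl) (.inr h0D)
  have hbel : ∀ e, S.L x e → S.Tendon (V 0) x e → g e < g x := by
    intro e hxe ht
    rcases E.chainTouched_x with h | h | h
    · exact (h.2 e hxe ht).1
    · exact absurd (h.2 y E.left ht0).1 (by omega)
    · exact absurd (h.2 y (.inl ⟨E.left, ht0⟩)) (by omega)
  -- As for `x`, with the two directions of the chain and of time exchanged: now `w₀` is tested as a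
  -- record from below at time `D`.
  obtain ⟨w₀, ⟨hw₀x, hw₀y⟩, hw₀⟩ := E.ruler.exists_max
    (K := {z | (z = x ∨ S.L z x) ∧ S.L y z}) ⟨x, .inl rfl, E.left⟩
    (fun a ha b hb => by
      rcases ha.1 with rfl | h1 <;> rcases hb.1 with rfl | h2
      · exact .inl rfl
      · exact .inr (.inr h2)
      · exact .inr (.inl h1)
      · exact L_comparable h1 h2)
    (fun a ha b hb c h1 h2 => ⟨.inr (by
      rcases hb.1 with rfl | h
      exacts [h2, S.L_L h2 h]), S.L_L ha.2 h1⟩)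
  have hwy := hmax w₀ hw₀x hw₀y
  have hle : ∀ z, (z = x ∨ S.L z x) → S.L y z → g z ≤ g w₀ := fun z h1 h2 => by
    by_cases h : z = w₀
    · rw [h]
    · exact (hw₀ z ⟨h1, h2⟩ h).le
  have hyw : y ≠ w₀ := by rintro rfl; exact L_irrefl _ hw₀y
  -- Either `y` is visited or a record from below, which gives the bound at once, or `y` dominates
  -- the tendon above it at time `D` but not at time `0`. The key that beats it must then be
  -- visited, and only in phase `D`.
  have hH : g w₀ ≤ H D := by
    by_cases hyD : y ∈ V D
    · exact hwy.le.trans (E.level D le_rfl y hyD)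
    have above : (∀ e, S.L e y → S.Tendon (V D) e y → g e < g y) → g w₀ ≤ H D := by
      intro hab
      have hex : ∃ e, S.L e y ∧ S.Tendon (V 0) e x ∧ g y ≤ g e := by
        by_contra! hcon
        refine E.not_touched (Nat.zero_le D) E.left (.inl rfl) (.inr h0D) (.inr (.inl (.inr (.inr
          ⟨E.allLeft (Nat.zero_le D) E.left (.inl rfl) (.inr h0D), ?_⟩))))
        rintro e (⟨hey, ht⟩ | ⟨hye, ht⟩)
        · exact hcon e hey (ht.trans ht0)
        · obtain ⟨v, hv, hxv⟩ := E.exists_L (Nat.zero_le D)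
          have hev : S.L e v := ht v hv (S.L_L E.left hxv).sub
          rcases L_comparable hev hxv with rfl | h | h
          · exact hgx
          · exact hmax e (.inr h) hye
          · exact (hbel e h (ht.upper E.left)).trans hgx
      obtain ⟨e, hey, ⟨ht, hge⟩, hlow⟩ := exists_lowest hex
      by_cases hv : ∃ b, 1 ≤ b ∧ b ≤ D ∧ e ∈ V b
      · obtain ⟨b, hb1, hbD, heb⟩ := hv
        obtain rfl : b = D := by
          by_contra hbD'
          refine E.not_touched hbD E.left (.inl rfl) (.inr hbD') (E.touched_of_above hbD heb hey
            (E.allLeft hbD E.left (.inl rfl) (.inr hbD')) fun w hew hwy' => ?_)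
          have : g w < g y := by
            by_contra hc
            exact hlow w hew hwy' ⟨ht.upper hew, by omega⟩
          exact ⟨this, by omega⟩
        have := E.level b le_rfl e heb
        omega
      · push Not at hv
        have := hab e hey ((E.tendon_up ht hv le_rfl).lower E.left)
        omega
    have htl := E.tendon_last hyD
    rcases E.chainTouched_y hyD with h | h | h
    · refine (h.2 w₀ hw₀y ?_).2
      rcases hw₀x with rfl | h'
      exacts [htl, htl.lower h']
    · exact above fun e h1 h2 => (h.2 e h1 h2).1
    · exact above fun e h1 h2 => h.2 e (.inl ⟨h1, h2⟩)
  have hex : ∃ e, S.L x e ∧ S.Tendon (V D) x e ∧ g w₀ ≤ g e := by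
    by_contra! hcon
    have hl : S.AllLeft (V D) w₀ := by
      rcases hw₀x with rfl | h
      exacts [E.allLeft_x le_rfl, E.allLeft le_rfl h (.inr hw₀y) (.inl hyw.symm)]
    have htx : ∀ e, S.L w₀ e → S.Tendon (V D) w₀ e → S.L x e → S.Tendon (V D) x e := by
      intro e _ ht _
      rcases hw₀x with rfl | h
      exacts [ht, ht.upper h]
    have htouch : S.Touched (V D) g l (H D) w₀ := by
      refine .inr (.inl (.inl ⟨hl, fun e he ht => ?_⟩))
      have hew : e ≠ w₀ := by rintro rfl; exact L_irrefl _ he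
      have : g e < g w₀ := by
        obtain ⟨v, hv, hxv⟩ := E.exists_L (le_refl D)
        have hwv : S.L w₀ v := by
          rcases hw₀x with rfl | h
          exacts [hxv, S.L_L h hxv]
        rcases L_comparable (ht v hv hwv.sub) hxv with h | h | h
        · exact hw₀ e ⟨.inl h, S.L_L hw₀y he⟩ hew
        · exact hw₀ e ⟨.inr h, S.L_L hw₀y he⟩ hew
        · exact hcon e h (htx e he ht h)
      exact ⟨this, by omega⟩
    rcases hw₀x with rfl | h
    · exact E.not_touched_x le_rfl h0D.symm htouch
    · exact E.not_touched le_rfl h (.inr hw₀y) (.inl hyw.symm) htouch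
  obtain ⟨e, hxe, ⟨ht, hge⟩, hhigh⟩ := exists_highest hex
  by_cases hv : ∃ b, b < D ∧ e ∈ V b
  · obtain ⟨b, hbD, heb⟩ := hv
    refine E.not_touched hbD.le E.left (.inl rfl) (.inr hbD.ne) (E.touched_of_below hbD.le heb
      (S.L_L E.left hxe) (E.allLeft hbD.le E.left (.inl rfl) (.inr hbD.ne)) fun w hyw' hwe => ?_)
    have : g w ≤ g w₀ := by
      rcases L_comparable hwe hxe with h | h | h
      · exact hle w (.inl h) hyw'
      · exact hle w (.inr h) hyw'
      · by_contra hc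
        exact hhigh w h hwe ⟨ht.lower hwe, by omega⟩
    exact ⟨by omega, by omega⟩
  · push Not at hv
    have := hbel e hxe (E.tendon_down ht hv)
    have := hle x (.inl rfl) E.left
    omega

theorem false [Finite α] (E : EmptyRect S g l V H D x y) : False := by
  obtain ⟨u, ⟨hux, huy⟩, hu⟩ := E.ruler.exists_max
    (K := {z | (z = x ∨ S.L z x) ∧ (z = y ∨ S.L y z)}) ⟨x, .inl rfl, .inr E.left⟩
    (fun a ha b hb => by
      rcases ha.1 with rfl | h1 <;> rcases hb.1 with rfl | h2
      · exact .inl rfl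
      · exact .inr (.inr h2)
      · exact .inr (.inl h1)
      · exact L_comparable h1 h2)
    (fun a ha b hb c h1 h2 => ⟨.inr (by
      rcases hb.1 with rfl | h
      exacts [h2, S.L_L h2 h]), .inr (by
      rcases ha.2 with rfl | h
      exacts [h1, S.L_L h h1])⟩)
  rcases hux with rfl | hux
  · exact E.not_max_x fun z h1 h2 => hu z ⟨.inr h1, h2⟩ (by rintro rfl; exact L_irrefl _ h1)
  rcases huy with rfl | huy
  · exact E.not_max_y fun z h1 h2 => hu z ⟨h1, .inr h2⟩ (by rintro rfl; exact L_irrefl _ h2)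
  · exact E.not_max_inside hux huy fun z h1 h2 h3 => hu z ⟨h1, h2⟩ h3

end EmptyRect
end SearchOrder
end DynBST

/-! ### Satisfaction of the touched points, and their number -/

namespace DynBST
namespace SearchOrder

variable {α : Type} {S : SearchOrder α} {g l : α → ℕ}

/-- Between two touched points with different keys and times there is a third touched point. -/
theorem exists_touched_between_of_lt [Finite α] (hg : S.IsRuler g) (hl : S.dual.IsRuler l)
    {V : ℕ → Finset α} {H : ℕ → ℕ} (hgH : ∀ b, ∀ v ∈ V b, g v ≤ H b)
    (hlH : ∀ b, ∀ v ∈ V b, l v ≤ H b) (hfwd : ∀ b, S.Link (V b) (V (b + 1)))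
    (hbwd : ∀ b, S.Link (V (b + 1)) (V b)) (s D : ℕ) (hD : 1 ≤ D) (x y : α) (hxy : S.lt x y)
    (hx : S.Touched (V s) g l (H s) x) (hy : S.Touched (V (s + D)) g l (H (s + D)) y) :
    ∃ c z, s ≤ c ∧ c ≤ s + D ∧ S.Touched (V c) g l (H c) z ∧
      (z = x ∨ S.lt x z) ∧ (z = y ∨ S.lt z y) ∧ ¬(z = x ∧ c = s) ∧ ¬(z = y ∧ c = s + D) := by
  by_contra hcon
  have hempty : ∀ c z, s ≤ c → c ≤ s + D → (z = x ∨ S.lt x z) → (z = y ∨ S.lt z y) →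
      S.Touched (V c) g l (H c) z → (z = x ∧ c = s) ∨ (z = y ∧ c = s + D) := by
    intro c z h1 h2 h3 h4 h5
    by_contra h6
    rw [not_or] at h6
    exact hcon ⟨c, z, h1, h2, h5, h3, h4, h6.1, h6.2⟩
  rcases S.lca hxy with h | h | ⟨a, h1, h2⟩
  · refine EmptyRect.false (S := S) (g := g) (l := l) (V := fun b => V (s + b))
      (H := fun b => H (s + b)) (D := D) (x := x) (y := y)
      ⟨hg, fun b _ => hgH _, fun b _ => hfwd _, fun b _ => hbwd _, h, hD, hx, hy, ?_⟩
    intro b hb z h1 h2 h3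
    rcases hempty (s + b) z (by omega) (by omega) h1 h2 h3 with ⟨h4, h5⟩ | ⟨h4, h5⟩
    exacts [.inl ⟨h4, by omega⟩, .inr ⟨h4, by omega⟩]
  -- Here the ancestor is touched first and to the left. Reflecting both keys and time makes `y` the
  -- lower corner at time `0`.
  · have hlink : ∀ b < D, s + D - b = (s + D - (b + 1)) + 1 := fun b hb => by omega
    refine EmptyRect.false (S := S.dual) (g := l) (l := g) (V := fun b => V (s + D - b))
      (H := fun b => H (s + D - b)) (D := D) (x := y) (y := x)
      ⟨hl, fun b _ => hlH _, fun b hb => ?_, fun b hb => ?_, h, hD, dual_touched.2 hy,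
        dual_touched.2 (by simpa using hx), ?_⟩
    · rw [hlink b hb]; exact (hbwd _).dual
    · rw [hlink b hb]; exact (hfwd _).dual
    · intro b hb z h1 h2 h3
      rcases hempty (s + D - b) z (by omega) (by omega) h2 h1 (dual_touched.1 h3) with
        ⟨h4, h5⟩ | ⟨h4, h5⟩
      exacts [.inr ⟨h4, by omega⟩, .inl ⟨h4, by omega⟩]
  -- If the separating key `a` is untouched, the links keep a visited key in its left subtree up to
  -- time `s + D`, when there is one in its right subtree as well; so `a` is branching after all.
  · have hax : a ≠ x := by rintro rfl; exact L_irrefl _ h1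
    have hay : a ≠ y := by rintro rfl; exact S.lt_irrefl _ (S.R_lt h2)
    have hna : ∀ c, s ≤ c → c ≤ s + D → ¬S.Touched (V c) g l (H c) a := by
      intro c h3 h4 h5
      rcases hempty c a h3 h4 (.inr (S.L_lt h1)) (.inr (S.R_lt h2)) h5 with ⟨h, -⟩ | ⟨h, -⟩
      exacts [hax h, hay h]
    have hL : ∀ i ≤ D, ∃ v ∈ V (s + i), S.L a v := by
      intro i
      induction i with
      | zero =>
        intro _
        obtain ⟨v, hv, hxv⟩ := hx.exists_sub
        exact ⟨v, hv, L_sub h1 hxv⟩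
      | succ i ih =>
        intro hi
        obtain ⟨v, hv, hav⟩ := ih (by omega)
        obtain ⟨v', -, h3, h4⟩ := hfwd (s + i) v hv
        exact ⟨v', h3, (h4 a fun ha => hna (s + i) (by omega) (by omega) (.inl (.inl ha))).1.1 hav⟩
    obtain ⟨v, hv, hyv⟩ := hy.exists_sub
    exact hna (s + D) (by omega) le_rfl (.inl (.inr ⟨hL D le_rfl, ⟨v, hv, R_sub h2 hyv⟩⟩))

/-! ### Counting touched keys -/

theorem exists_common_ancestor {q : α} (A : Finset α) (hne : A.Nonempty) (hA : ∀ v ∈ A, S.L q v) :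
    ∃ w, S.L q w ∧ ∀ v ∈ A, S.Sub w v := by
  induction hne using Finset.Nonempty.cons_induction with
  | singleton a => exact ⟨a, hA a (by simp), by simp [Sub.refl]⟩
  | cons v A hv hne ih =>
    obtain ⟨w, hqw, hw⟩ := ih fun v hv => hA v (by simp [hv])
    have hqv : S.L q v := hA v (by simp)
    have of_w : S.Sub w v → ∃ w, S.L q w ∧ ∀ z ∈ Finset.cons v A hv, S.Sub w z := by
      intro h
      refine ⟨w, hqw, fun z hz => ?_⟩
      rcases Finset.mem_cons.1 hz with rfl | hz
      exacts [h, hw z hz]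
    have of_a : ∀ a, S.L q a → S.Sub a w → S.Sub a v →
        ∃ w, S.L q w ∧ ∀ z ∈ Finset.cons v A hv, S.Sub w z := by
      intro a h1 h2 h3
      refine ⟨a, h1, fun z hz => ?_⟩
      rcases Finset.mem_cons.1 hz with rfl | hz
      exacts [h3, h2.trans (hw z hz)]
    have hqa : ∀ {a c d}, S.L q c → S.L q d → S.L a c → S.R a d → S.L q a := by
      intro a c d hc hd h1 h2
      rcases L_comparable hc h1 with rfl | h | h
      · exact absurd h2 (L_not_R hd)
      · exact h
      · exact absurd h2 (L_not_R (S.L_L h hd))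
    rcases S.lt_tri w v with h | rfl | h
    · rcases S.lca h with h | h | ⟨a, h1, h2⟩
      · exact of_a v hqv h.sub (.refl v)
      · exact of_w h.sub
      · exact of_a a (hqa hqw hqv h1 h2) h1.sub h2.sub
    · exact of_w (.refl w)
    · rcases S.lca h with h | h | ⟨a, h1, h2⟩
      · exact of_w h.sub
      · exact of_a v hqv h.sub (.refl v)
      · exact of_a a (hqa hqv hqw h1 h2) h2.sub h1.sub

/-- Below every key there is a pivot with the same keys of `V` below it. -/
theorem exists_pivot_sub [Finite α] (V : Finset α) (u : α) (hu : ∃ v ∈ V, S.Sub u v) :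
    ∃ q, S.Pivot V q ∧ S.Sub u q ∧ ∀ v ∈ V, S.Sub u v → S.Sub q v := by
  have : IsTrans α (fun a b => S.L b a ∨ S.R b a) := ⟨by
    rintro a b c (h | h) (h' | h')
    exacts [.inl (S.L_L h' h), .inr (S.R_L h' h), .inl (S.L_R h' h), .inr (S.R_R h' h)]⟩
  have : Std.Irrefl (fun a b => S.L b a ∨ S.R b a) := ⟨by
    rintro a (h | h)
    exacts [L_irrefl a h, S.lt_irrefl _ (S.R_lt h)]⟩
  have wf := Finite.wellFounded_of_trans_of_irrefl (fun a b => S.L b a ∨ S.R b a)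
  obtain ⟨q, ⟨h1, h2⟩, h3⟩ := wf.has_min {q | S.Sub u q ∧ ∀ v ∈ V, S.Sub u v → S.Sub q v}
    ⟨u, .refl u, fun v _ h => h⟩
  refine ⟨q, ?_, h1, h2⟩
  by_contra hq
  have hqV : q ∉ V := fun h => hq (.inl h)
  classical
  have hne : (V.filter (S.Sub u ·)).Nonempty := by
    obtain ⟨v, hv, h⟩ := hu
    exact ⟨v, by simp [hv, h]⟩
  obtain ⟨v, hv, huv⟩ := hu
  have hnb : ¬S.Branching V q := fun h => hq (.inr h)
  rcases h2 v hv huv with rfl | hqv | hqv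
  · exact hqV hv
  · obtain ⟨w, hw1, hw2⟩ := exists_common_ancestor (S := S) (q := q) _ hne (by
      intro z hz
      rw [Finset.mem_filter] at hz
      rcases h2 z hz.1 hz.2 with rfl | h | h
      exacts [absurd hz.1 hqV, h, absurd ⟨⟨v, hv, hqv⟩, ⟨z, hz.1, h⟩⟩ hnb])
    exact h3 w ⟨h1.trans hw1.sub, fun z hz huz => hw2 z (by simp [hz, huz])⟩ (.inl hw1)
  · obtain ⟨w, hw1, hw2⟩ := exists_common_ancestor (S := S.dual) (q := q) _ hne (by
      intro z hz
      rw [Finset.mem_filter] at hz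
      rcases h2 z hz.1 hz.2 with rfl | h | h
      exacts [absurd hz.1 hqV, absurd ⟨⟨z, hz.1, h⟩, ⟨v, hv, hqv⟩⟩ hnb, h])
    exact h3 w ⟨h1.trans (R.sub hw1), fun z hz huz => dual_sub.1 (hw2 z (by simp [hz, huz]))⟩
      (.inr hw1)

open Classical in
theorem card_pivot_le [Fintype α] (V : Finset α) :
    (Finset.univ.filter (S.Pivot V ·)).card ≤ 2 * V.card := by
  have hB : (Finset.univ.filter (S.Branching V ·)).card ≤ V.card := by
    have : IsTrans α S.lt := ⟨fun a b c h h' => S.lt_trans h h'⟩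
    have : Std.Irrefl S.lt := ⟨S.lt_irrefl⟩
    have wf := Finite.wellFounded_of_trans_of_irrefl S.lt
    -- Charge a branching key to the least key of `V` in its right subtree. This is injective: if
    -- `u'` lies to the right of `u`, a key of `V` to the left of `u'` is smaller than the charge of
    -- `u'`.
    have hmin : ∀ u, S.Branching V u → ∃ v ∈ V, S.R u v ∧ ∀ w ∈ V, S.R u w → ¬S.lt w v := by
      rintro u ⟨-, v, hv, huv⟩
      obtain ⟨w, ⟨h1, h2⟩, h3⟩ := wf.has_min {w | w ∈ V ∧ S.R u w} ⟨v, hv, huv⟩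
      exact ⟨w, h1, h2, fun z hz huz => h3 z ⟨hz, huz⟩⟩
    choose! f hfV hfR hfmin using hmin
    refine Finset.card_le_card_of_injOn f (fun u hu => hfV u (by simpa using hu)) ?_
    intro u hu u' hu' heq
    have hu : S.Branching V u := by simpa using hu
    have hu' : S.Branching V u' := by simpa using hu'
    have key : ∀ {u u'}, S.Branching V u → S.Branching V u' → f u = f u' → ¬S.R u u' := by
      rintro u u' hu hu' heq h
      obtain ⟨v, hv, hv'⟩ := hu'.1
      refine hfmin u hu v hv (S.R_L h hv') ?_
      rw [heq]
      exact S.lt_trans (S.L_lt hv') (S.R_lt (hfR u' hu'))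
    rcases L_comparable (S := S.dual) (u := u) (w := u') (z := f u) (hfR u hu)
      (heq ▸ hfR u' hu') with h | h | h
    · exact h
    · exact absurd h (key hu hu' heq)
    · exact absurd h (key hu' hu heq.symm)
  have hsub : Finset.univ.filter (S.Pivot V ·) ⊆ V ∪ Finset.univ.filter (S.Branching V ·) := by
    intro u hu
    rw [Finset.mem_filter] at hu
    rcases hu.2 with h | h
    exacts [Finset.mem_union_left _ h, Finset.mem_union_right _ (by simpa using h)]
  have := (Finset.card_le_card hsub).trans (Finset.card_union_le _ _)
  omega

-- Group the keys by a pivot with the same keys of `V` below; the keys of one group form a left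
-- chain on a single tendon. Along the records from one end the values increase and all but the last
-- are at most `H`, so they stay distinct when capped at `H + 1`. This allows `H + 2` records from
-- each end, plus one maximum, for each of at most `2 * V.card` pivots.
open Classical in
theorem card_chainTouched_le [Fintype α] (V : Finset α) (g : α → ℕ) (H : ℕ) :
    (Finset.univ.filter (S.ChainTouched V g H ·)).card ≤ 2 * V.card * (2 * H + 5) := by
  have hP := card_pivot_le (S := S) V
  set P := Finset.univ.filter (S.Pivot V ·) with hPdef
  have hex : ∀ u, S.AllLeft V u → ∃ q, S.Pivot V q ∧ S.Sub u q ∧ ∀ v ∈ V, S.Sub u v → S.Sub q v :=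
    fun u hu => exists_pivot_sub V u hu.1
  choose! f hf1 hf2 hf3 using hex
  have hcomp : ∀ {u u'}, S.AllLeft V u → S.AllLeft V u' → f u = f u' →
      S.Tendon V u u' ∧ S.Tendon V u' u ∧ (u = u' ∨ S.L u u' ∨ S.L u' u) := by
    have key : ∀ {u u'}, S.AllLeft V u → S.AllLeft V u' → f u = f u' → S.Tendon V u u' := by
      intro u u' hu hu' heq v hv huv
      have := hf3 u hu v hv huv
      rw [heq] at this
      exact hu'.2 v hv ((hf2 u' hu').trans this)
    intro u u' hu hu' heq
    obtain ⟨v, hv, huv⟩ := hu.1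
    have h1 := key hu hu' heq
    exact ⟨h1, key hu' hu heq.symm, L_comparable (hu.2 v hv huv) (h1 v hv huv)⟩
  have hcard : ∀ Q : α → Prop, (∀ u, Q u → S.AllLeft V u) →
      (∀ u u', Q u → Q u' → f u = f u' → S.L u u' → min (g u) (H + 1) ≠ min (g u') (H + 1)) →
      (Finset.univ.filter Q).card ≤ P.card * (H + 2) := by
    intro Q hQ hinj
    have hle : (Finset.univ.filter Q).card ≤ (P ×ˢ Finset.range (H + 2)).card := by
      refine Finset.card_le_card_of_injOn (fun u => (f u, min (g u) (H + 1))) ?_ ?_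
      · intro u hu
        have hu : Q u := by simpa using hu
        simp only [Finset.coe_product, Set.mem_prod, Finset.mem_coe, Finset.mem_range, hPdef,
          Finset.mem_filter, Finset.mem_univ, true_and]
        exact ⟨hf1 u (hQ u hu), by omega⟩
      · intro u hu u' hu' heq
        have hu : Q u := by simpa using hu
        have hu' : Q u' := by simpa using hu'
        simp only [Prod.mk.injEq] at heq
        rcases (hcomp (hQ u hu) (hQ u' hu') heq.1).2.2 with h | h | h
        · exact h
        · exact absurd heq.2 (hinj u u' hu hu' heq.1 h)
        · exact absurd heq.2.symm (hinj u' u hu' hu heq.1.symm h)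
    simpa [Finset.card_product] using hle
  have h1 := hcard (S.RecordBelow V g H) (fun u hu => hu.1) (by
    intro u u' hu hu' heq h
    have := hu.2 u' h (hcomp hu.1 hu'.1 heq).1
    omega)
  have h2 := hcard (S.RecordAbove V g H) (fun u hu => hu.1) (by
    intro u u' hu hu' heq h
    have := hu'.2 u h (hcomp hu.1 hu'.1 heq).1
    omega)
  have h3 : (Finset.univ.filter (S.Top V g)).card ≤ P.card := by
    refine Finset.card_le_card_of_injOn f (fun u hu => ?_) ?_
    · have hu : S.Top V g u := by simpa using hu
      simpa [hPdef] using hf1 u hu.1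
    · intro u hu u' hu' heq
      have hu : S.Top V g u := by simpa using hu
      have hu' : S.Top V g u' := by simpa using hu'
      obtain ⟨h1, h2, h3⟩ := hcomp hu.1 hu'.1 heq
      rcases h3 with h | h | h
      · exact h
      · have h4 := hu.2 u' (.inr ⟨h, h1⟩)
        have h5 := hu'.2 u (.inl ⟨h, h1⟩)
        omega
      · have h4 := hu.2 u' (.inl ⟨h, h2⟩)
        have h5 := hu'.2 u (.inr ⟨h, h2⟩)
        omega
  have hsub : Finset.univ.filter (S.ChainTouched V g H ·) ⊆
      Finset.univ.filter (S.RecordBelow V g H) ∪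
        (Finset.univ.filter (S.RecordAbove V g H) ∪ Finset.univ.filter (S.Top V g)) := by
    intro u hu
    have hu : S.RecordBelow V g H u ∨ S.RecordAbove V g H u ∨ S.Top V g u :=
      (Finset.mem_filter.1 hu).2
    simpa using hu
  have h4 := (Finset.card_le_card hsub).trans (Finset.card_union_le _ _)
  have h5 := Finset.card_union_le (Finset.univ.filter (S.RecordAbove V g H))
    (Finset.univ.filter (S.Top V g))
  calc _ ≤ P.card * (2 * H + 5) := by
        rw [show P.card * (2 * H + 5) = P.card * (H + 2) + (P.card * (H + 2) + P.card) by ring]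
        omega
    _ ≤ _ := Nat.mul_le_mul_right _ hP

open Classical in
/-- The set of touched keys. -/
noncomputable def touchedSet [Fintype α] (S : SearchOrder α) (V : Finset α) (g l : α → ℕ) (H : ℕ) :
    Finset α := Finset.univ.filter (S.Touched V g l H ·)

theorem mem_touchedSet [Fintype α] {V : Finset α} {H : ℕ} {u : α} :
    u ∈ S.touchedSet V g l H ↔ S.Touched V g l H u := by
  simp [touchedSet]

theorem card_touchedSet_le [Fintype α] (V : Finset α) (H : ℕ) :
    (S.touchedSet V g l H).card ≤ V.card * (8 * H + 22) := by
  classical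
  have h1 := card_pivot_le (S := S) V
  have h2 := card_chainTouched_le (S := S) V g H
  have h3 := card_chainTouched_le (S := S.dual) V l H
  have hsub : S.touchedSet V g l H ⊆ Finset.univ.filter (S.Pivot V ·) ∪
      (Finset.univ.filter (S.ChainTouched V g H ·) ∪
        Finset.univ.filter (S.dual.ChainTouched V l H ·)) := by
    intro u hu
    rw [mem_touchedSet] at hu
    simpa [Touched] using hu
  have h4 := (Finset.card_le_card hsub).trans (Finset.card_union_le _ _)
  have h5 := Finset.card_union_le (Finset.univ.filter (S.ChainTouched V g H ·))
    (Finset.univ.filter (S.dual.ChainTouched V l H ·))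
  have h6 : V.card * (8 * H + 22) =
      2 * V.card + (2 * V.card * (2 * H + 5) + 2 * V.card * (2 * H + 5)) := by ring
  omega

end SearchOrder

/-- The sets touched at the boundaries between the phases. -/
noncomputable def boundarySet {n : ℕ} (W : ℕ → Finset (Fin n)) (B b : ℕ) : Finset (Fin n) :=
  if b ≤ B then W (b - 1) ∪ W b else Finset.univ

/-- Up to time `B`, a key of `W b` is also touched at time `b + 1`, so a corner can often be
repeated one step inward. What remains are rectangles from `W (s - 1)` to `W t`, settled by `hW`; a
third point at time `s - 1` reappears at time `s`. Touching all keys after `B` makes rectangles that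
end there trivial and every next touch exist. -/
theorem satisfied_boundarySet {n : ℕ} (W : ℕ → Finset (Fin n)) (B : ℕ)
    (hW : ∀ s D x y, 1 ≤ D → x ≠ y → x ∈ W s → y ∈ W (s + D) →
      ∃ c z, s ≤ c ∧ c ≤ s + D ∧ z ∈ W c ∧ (x ≤ z ∧ z ≤ y ∨ y ≤ z ∧ z ≤ x) ∧
        ¬(z = x ∧ c = s) ∧ ¬(z = y ∧ c = s + D)) : Satisfied (boundarySet W B) := by
  intro s t x y hst hx hy hxy
  have hend : ∀ z, z = x ∨ z = y → (x ≤ z ∧ z ≤ y ∨ y ≤ z ∧ z ≤ x) := by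
    rintro z (rfl | rfl)
    · exact (le_total z y).imp (fun h => ⟨le_rfl, h⟩) (fun h => ⟨h, le_rfl⟩)
    · exact (le_total x z).imp (fun h => ⟨h, le_rfl⟩) (fun h => ⟨le_rfl, h⟩)
  by_cases ht : t ≤ B
  swap
  · exact ⟨t, x, hst.le, le_rfl, by simp [boundarySet, ht], hend x (.inl rfl), by omega,
      fun h => hxy h.1⟩
  simp only [boundarySet, hst.le.trans ht, ht, if_true, Finset.mem_union] at hx hy
  have hmem : ∀ c z, c ≤ B → (z ∈ W (c - 1) ∨ z ∈ W c) → z ∈ boundarySet W B c := by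
    intro c z hc h
    simpa [boundarySet, hc] using h
  by_cases hxs : x ∈ W s
  · exact ⟨s + 1, x, by omega, by omega, hmem _ _ (by omega) (.inl hxs), hend x (.inl rfl),
      by omega, fun h => hxy h.1⟩
  have hx := hx.resolve_right hxs
  by_cases hyt : y ∈ W (t - 1)
  · exact ⟨t - 1, y, by omega, by omega, hmem _ _ (by omega) (.inr hyt), hend y (.inr rfl),
      fun h => hxy h.1.symm, by omega⟩
  have hy := hy.resolve_left hyt
  have hs : s ≠ 0 := by rintro rfl; exact hxs hx
  obtain ⟨c, z, h1, h2, h3, h4, h5, h6⟩ := hW (s - 1) (t - (s - 1)) x y (by omega) hxy hx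
    (by rwa [show s - 1 + (t - (s - 1)) = t by omega])
  rw [show s - 1 + (t - (s - 1)) = t by omega] at h2 h6
  by_cases hc : c = s - 1
  · subst hc
    exact ⟨s, z, le_rfl, hst.le, hmem _ _ (by omega) (.inl h3), h4,
      fun h => h5 ⟨h.1, rfl⟩, by omega⟩
  · refine ⟨c, z, by omega, h2, hmem _ _ (by omega) (.inr h3), h4, ?_, h6⟩
    rintro ⟨rfl, rfl⟩
    exact hxs h3

/-! ### The search order of a binary search tree -/

/-- `w` lies in the left (if `b`) or right (otherwise) subtree of the node of `T` with key `u`. -/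
def InSub {α : Type} (b : Bool) : BinaryTree α → α → α → Prop
  | .nil, _, _ => False
  | .node a l r, u, w => (u = a ∧ w ∈ inorder (bif b then l else r)) ∨ InSub b l u w ∨ InSub b r u w

section InSub

variable {α : Type}

theorem InSub.mem {b : Bool} {T : BinaryTree α} {u w : α} (h : InSub b T u w) :
    u ∈ inorder T ∧ w ∈ inorder T := by
  induction T with
  | nil => exact h.elim
  | node a l r ihl ihr =>
    simp only [inorder, List.mem_append, List.mem_cons]
    rcases h with ⟨rfl, h⟩ | h | h
    · cases b <;> simp_all
    · exact ⟨.inl (ihl h).1, .inl (ihl h).2⟩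
    · exact ⟨.inr (.inr (ihr h).1), .inr (.inr (ihr h).2)⟩

theorem mem_of_rootKey {T : BinaryTree α} {c : α} (h : rootKey T = some c) : c ∈ inorder T := by
  cases T with
  | nil => simp [rootKey] at h
  | node a l r =>
    obtain rfl : a = c := by simpa [rootKey] using h
    simp [inorder]

theorem IsChild.mem {T : BinaryTree α} {p c : α} (h : IsChild T p c) :
    p ∈ inorder T ∧ c ∈ inorder T := by
  induction T with
  | nil => exact h.elim
  | node a l r ihl ihr =>
    simp only [inorder, List.mem_append, List.mem_cons]
    rcases h with ⟨rfl, h | h⟩ | h | h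
    · exact ⟨.inr (.inl rfl), .inl (mem_of_rootKey h)⟩
    · exact ⟨.inr (.inl rfl), .inr (.inr (mem_of_rootKey h))⟩
    · exact ⟨.inl (ihl h).1, .inl (ihl h).2⟩
    · exact ⟨.inr (.inr (ihr h).1), .inr (.inr (ihr h).2)⟩

variable [LinearOrder α]

/-- The order relations at the root of a search tree. -/
theorem sorted_node {a : α} {l r : BinaryTree α}
    (h : (inorder (.node a l r)).Pairwise (· < ·)) :
    (inorder l).Pairwise (· < ·) ∧ (inorder r).Pairwise (· < ·) ∧ (∀ x ∈ inorder l, x < a) ∧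
      (∀ x ∈ inorder r, a < x) := by
  rw [inorder, List.pairwise_append, List.pairwise_cons] at h
  obtain ⟨h1, ⟨h2, h3⟩, h4⟩ := h
  exact ⟨h1, h3, fun x hx => h4 x hx a (by simp), h2⟩

theorem InSub.trans {b b' : Bool} {T : BinaryTree α} (hT : (inorder T).Pairwise (· < ·))
    {u w z : α} (h : InSub b T u w) (h' : InSub b' T w z) : InSub b T u z := by
  induction T with
  | nil => exact h.elim
  | node a l r ihl ihr =>
    obtain ⟨h1, h2, h3, h4⟩ := sorted_node hT
    have hdisj : ∀ x ∈ inorder l, x ∉ inorder r := fun x hx hx' =>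
      lt_asymm (h3 x hx) (h4 x hx')
    have of_left : w ∈ inorder l → InSub b' l w z := by
      intro hw
      rcases h' with ⟨rfl, -⟩ | h' | h'
      exacts [absurd (h3 w hw) (lt_irrefl w), h', absurd h'.mem.1 (hdisj w hw)]
    have of_right : w ∈ inorder r → InSub b' r w z := by
      intro hw
      rcases h' with ⟨rfl, -⟩ | h' | h'
      exacts [absurd (h4 w hw) (lt_irrefl w), absurd hw (hdisj w h'.mem.1), h']
    rcases h with ⟨rfl, h⟩ | h | h
    · cases b
      · exact .inl ⟨rfl, (of_right h).mem.2⟩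
      · exact .inl ⟨rfl, (of_left h).mem.2⟩
    · exact .inr (.inl (ihl h1 h (of_left h.mem.2)))
    · exact .inr (.inr (ihr h2 h (of_right h.mem.2)))

theorem InSub.lt_left {T : BinaryTree α} (hT : (inorder T).Pairwise (· < ·)) {u w : α}
    (h : InSub true T u w) : w < u := by
  induction T with
  | nil => exact h.elim
  | node a l r ihl ihr =>
    obtain ⟨h1, h2, h3, h4⟩ := sorted_node hT
    rcases h with ⟨rfl, h⟩ | h | h
    exacts [h3 w h, ihl h1 h, ihr h2 h]

theorem InSub.lt_right {T : BinaryTree α} (hT : (inorder T).Pairwise (· < ·)) {u w : α}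
    (h : InSub false T u w) : u < w := by
  induction T with
  | nil => exact h.elim
  | node a l r ihl ihr =>
    obtain ⟨h1, h2, h3, h4⟩ := sorted_node hT
    rcases h with ⟨rfl, h⟩ | h | h
    exacts [h4 w h, ihl h1 h, ihr h2 h]

theorem exists_lca {T : BinaryTree α} (hT : (inorder T).Pairwise (· < ·)) {x y : α}
    (hx : x ∈ inorder T) (hy : y ∈ inorder T) (hxy : x < y) :
    InSub true T y x ∨ InSub false T x y ∨ ∃ a, InSub true T a x ∧ InSub false T a y := by
  induction T with
  | nil => simp [inorder] at hx
  | node a l r ihl ihr =>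
    obtain ⟨h1, h2, h3, h4⟩ := sorted_node hT
    simp only [inorder, List.mem_append, List.mem_cons] at hx hy
    rcases hx with hx | rfl | hx <;> rcases hy with hy | rfl | hy
    · rcases ihl h1 hx hy with h | h | ⟨c, h, h'⟩
      exacts [.inl (.inr (.inl h)), .inr (.inl (.inr (.inl h))),
        .inr (.inr ⟨c, .inr (.inl h), .inr (.inl h')⟩)]
    · exact .inl (.inl ⟨rfl, hx⟩)
    · exact .inr (.inr ⟨a, .inl ⟨rfl, hx⟩, .inl ⟨rfl, hy⟩⟩)
    · exact absurd (h3 y hy) hxy.not_gt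
    · exact absurd hxy (lt_irrefl _)
    · exact .inr (.inl (.inl ⟨rfl, hy⟩))
    · exact absurd ((h3 y hy).trans (h4 x hx)) hxy.not_gt
    · exact absurd (h4 x hx) hxy.not_gt
    · rcases ihr h2 hx hy with h | h | ⟨c, h, h'⟩
      exacts [.inl (.inr (.inr h)), .inr (.inl (.inr (.inr h))),
        .inr (.inr ⟨c, .inr (.inr h), .inr (.inr h')⟩)]

theorem not_inSub_root {b : Bool} {a : α} {l r : BinaryTree α}
    (hT : (inorder (.node a l r)).Pairwise (· < ·)) (u : α) : ¬InSub b (.node a l r) u a := by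
  obtain ⟨-, -, h3, h4⟩ := sorted_node hT
  have hl : a ∉ inorder l := fun h => lt_irrefl a (h3 a h)
  have hr : a ∉ inorder r := fun h => lt_irrefl a (h4 a h)
  rintro (⟨rfl, h⟩ | h | h)
  · cases b
    exacts [hr h, hl h]
  · exact hl h.mem.2
  · exact hr h.mem.2

/-- The ends of an edge lie on the same side of every other key. -/
theorem IsChild.inSub_iff {b : Bool} {T : BinaryTree α} (hT : (inorder T).Pairwise (· < ·))
    {p c u : α} (h : IsChild T p c) (hp : u ≠ p) (hc : u ≠ c) :
    InSub b T u p ↔ InSub b T u c := by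
  induction T with
  | nil => exact h.elim
  | node a l r ihl ihr =>
    obtain ⟨h1, h2, h3, h4⟩ := sorted_node hT
    have hdisj : ∀ x ∈ inorder l, x ∉ inorder r := fun x hx hx' =>
      lt_asymm (h3 x hx) (h4 x hx')
    have root : ∀ s : BinaryTree α, (inorder s).Pairwise (· < ·) → rootKey s = some c →
        ¬InSub b s u c := by
      intro s hs hr
      cases s with
      | nil => simp [rootKey] at hr
      | node d s₁ s₂ =>
        obtain rfl : d = c := by simpa [rootKey] using hr
        exact not_inSub_root hs u
    rcases h with ⟨rfl, h⟩ | h | h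
    · refine iff_of_false (not_inSub_root hT u) ?_
      rintro (⟨rfl, -⟩ | h' | h')
      · exact hp rfl
      · rcases h with h | h
        · exact root l h1 h h'
        · exact hdisj c h'.mem.2 (mem_of_rootKey h)
      · rcases h with h | h
        · exact hdisj c (mem_of_rootKey h) h'.mem.2
        · exact root r h2 h h'
    · have hm := h.mem
      have e1 : ¬InSub b r u p := fun h' => hdisj p hm.1 h'.mem.2
      have e2 : ¬InSub b r u c := fun h' => hdisj c hm.2 h'.mem.2
      have e3 := ihl h1 h
      have e4 : p ∈ inorder (bif b then l else r) ↔ c ∈ inorder (bif b then l else r) := by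
        cases b
        · exact iff_of_false (hdisj p hm.1) (hdisj c hm.2)
        · exact iff_of_true hm.1 hm.2
      simp only [InSub, e1, e2, e3, e4]
    · have hm := h.mem
      have e1 : ¬InSub b l u p := fun h' => hdisj p h'.mem.2 hm.1
      have e2 : ¬InSub b l u c := fun h' => hdisj c h'.mem.2 hm.2
      have e3 := ihr h2 h
      have e4 : p ∈ inorder (bif b then l else r) ↔ c ∈ inorder (bif b then l else r) := by
        cases b
        · exact iff_of_true hm.1 hm.2
        · exact iff_of_false (fun h' => hdisj p h' hm.1) (fun h' => hdisj c h' hm.2)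
      simp only [InSub, e1, e2, e3, e4]

end InSub

theorem IsBST.sorted {n : ℕ} {T : BinaryTree (Fin n)} (hT : IsBST T) :
    (inorder T).Pairwise (· < ·) := by
  rw [show inorder T = _ from hT]; exact List.pairwise_lt_finRange n

theorem IsBST.mem {n : ℕ} {T : BinaryTree (Fin n)} (hT : IsBST T) (x : Fin n) : x ∈ inorder T := by
  rw [show inorder T = _ from hT]; exact List.mem_finRange x

/-- The search order of a binary search tree. -/
def searchOrder {n : ℕ} (T : BinaryTree (Fin n)) (hT : IsBST T) : SearchOrder (Fin n) where
  lt := (· < ·)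
  L := InSub true T
  R := InSub false T
  lt_irrefl := lt_irrefl
  lt_trans := lt_trans
  lt_tri := lt_trichotomy
  L_lt := InSub.lt_left hT.sorted
  R_lt := InSub.lt_right hT.sorted
  L_L := InSub.trans hT.sorted
  L_R := InSub.trans hT.sorted
  R_L := InSub.trans hT.sorted
  R_R := InSub.trans hT.sorted
  lca := exists_lca hT.sorted (hT.mem _) (hT.mem _)

theorem treeGraph_adj_side {n : ℕ} {T : BinaryTree (Fin n)} (hT : IsBST T) {p c u : Fin n}
    (h : (treeGraph T).Adj p c) (hp : u ≠ p) (hc : u ≠ c) (b : Bool) :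
    InSub b T u p ↔ InSub b T u c := by
  rw [treeGraph, SimpleGraph.fromRel_adj] at h
  rcases h.2 with h | h
  exacts [h.inSub_iff hT.sorted hp hc, (h.inSub_iff hT.sorted hc hp).symm]

/-! ### The ruler function -/

namespace SearchOrder

variable {α : Type} (S : SearchOrder α)

open Classical in
/-- The number of keys with `u` in their left subtree. -/
noncomputable def leftDepth [Fintype α] (u : α) : ℕ := (Finset.univ.filter (S.L · u)).card

variable {S}

theorem leftDepth_lt_card [Fintype α] (u : α) : S.leftDepth u < Fintype.card α := by
  classical
  refine Finset.card_lt_card ?_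
  refine ⟨Finset.filter_subset _ _, fun h => ?_⟩
  have := h (Finset.mem_univ u)
  simp [L_irrefl] at this

theorem leftDepth_lt [Fintype α] {u w : α} (h : S.L u w) : S.leftDepth u < S.leftDepth w := by
  classical
  refine Finset.card_lt_card ⟨fun z hz => ?_, fun h' => ?_⟩
  · simp only [Finset.mem_filter, Finset.mem_univ, true_and] at hz ⊢
    exact S.L_L hz h
  · have := @h' u (by simpa using h)
    simp [L_irrefl] at this

/-- Passing to the lowest left ancestor lowers the left depth by exactly one. So a left chain is
numbered consecutively, and a ruler on the integers can be pulled back to it. -/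
theorem exists_leftDepth_eq [Fintype α] (w : α) (j : ℕ) (hj : j < S.leftDepth w) :
    ∃ z, S.L z w ∧ S.leftDepth z = j := by
  classical
  induction hN : S.leftDepth w using Nat.strong_induction_on generalizing w with
  | _ N ih =>
  have hne : ∃ e, S.L e w ∧ True := by
    have : 0 < (Finset.univ.filter (S.L · w)).card := (Nat.zero_le j).trans_lt hj
    obtain ⟨e, he⟩ := Finset.card_pos.1 this
    exact ⟨e, by simpa using he, trivial⟩
  obtain ⟨z, hzw, -, hlow⟩ := exists_lowest hne
  have heq : S.leftDepth w = S.leftDepth z + 1 := by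
    have : Finset.univ.filter (S.L · w) = insert z (Finset.univ.filter (S.L · z)) := by
      ext t
      simp only [Finset.mem_filter, Finset.mem_univ, true_and, Finset.mem_insert]
      constructor
      · intro ht
        rcases L_comparable ht hzw with h | h | h
        exacts [.inl h, .inr h, absurd trivial (hlow t h ht)]
      · rintro (rfl | h)
        exacts [hzw, S.L_L h hzw]
    rw [leftDepth, this, Finset.card_insert_of_notMem (by simp [L_irrefl])]
    rfl
  by_cases hjz : j = S.leftDepth z
  · exact ⟨z, hzw, hjz.symm⟩
  · obtain ⟨t, h1, h2⟩ := ih _ (by omega) z (by omega) rfl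
    exact ⟨t, S.L_L h1 hzw, h2⟩

end SearchOrder

/-- Both numbers are odd multiples of `2 ^ i`. The next multiple after `a` has an even cofactor, and
it stays below `b` because two odd cofactors are not consecutive. -/
theorem exists_padicValNat_lt {a b : ℕ} (ha : 0 < a) (hab : a < b)
    (h : padicValNat 2 a = padicValNat 2 b) :
    ∃ c, a < c ∧ c < b ∧ padicValNat 2 a < padicValNat 2 c := by
  set i := padicValNat 2 a with hi
  obtain ⟨a', ha'⟩ : 2 ^ i ∣ a := pow_padicValNat_dvd
  obtain ⟨b', hb'⟩ : 2 ^ i ∣ b := h ▸ pow_padicValNat_dvd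
  have hodd : ∀ c c' : ℕ, c ≠ 0 → c = 2 ^ i * c' → padicValNat 2 c = i → c' % 2 = 1 := by
    intro c c' hc hcc hci
    by_contra hodd
    have h2 : 2 ^ (i + 1) ∣ c := by
      rw [hcc, pow_succ]
      exact Nat.mul_dvd_mul_left _ (by omega)
    rw [padicValNat_dvd_iff_le hc] at h2
    omega
  have h1 := hodd a a' ha.ne' ha' rfl
  have h2 := hodd b b' (by omega) hb' h.symm
  have hpos : 0 < 2 ^ i := by positivity
  have h3 : a' < b' := by
    rw [ha', hb'] at hab
    exact lt_of_mul_lt_mul_left hab hpos.le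
  refine ⟨2 ^ i * (a' + 1), ?_, ?_, ?_⟩
  · rw [ha']; exact Nat.mul_lt_mul_of_pos_left (by omega) hpos
  · rw [hb']; exact Nat.mul_lt_mul_of_pos_left (by omega) hpos
  · have h4 : 2 ^ (i + 1) ∣ 2 ^ i * (a' + 1) := by
      rw [pow_succ]
      exact Nat.mul_dvd_mul_left _ (by omega)
    rw [padicValNat_dvd_iff_le (by positivity)] at h4
    omega

/-- The dyadic ruler function on left chains, shifted by `r`. -/
noncomputable def SearchOrder.ruler {α : Type} [Fintype α] (S : SearchOrder α) (r : ℕ) (u : α) : ℕ :=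
  padicValNat 2 (S.leftDepth u + r)

/-- The integer found between the two shifted depths is attained on the chain. A positive shift
avoids the argument `0`, where the valuation takes a default value. -/
theorem SearchOrder.isRuler_ruler {α : Type} [Fintype α] (S : SearchOrder α) {r : ℕ} (hr : 0 < r) :
    S.IsRuler (ruler S r) := by
  intro u w huw heq
  have hlt := SearchOrder.leftDepth_lt huw
  obtain ⟨c, h1, h2, h3⟩ := exists_padicValNat_lt (by omega) (by omega) heq
  obtain ⟨z, hz1, hz2⟩ := SearchOrder.exists_leftDepth_eq (S := S) w (c - r) (by omega)
  refine ⟨z, ?_, hz1, ?_⟩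
  · rcases SearchOrder.L_comparable huw hz1 with rfl | h | h
    · omega
    · exact h
    · have := SearchOrder.leftDepth_lt h
      omega
  · rw [ruler, ruler, hz2, show c - r + r = c by omega]
    exact h3

/-! ### Averages of the shifted ruler -/

theorem card_filter_dvd_add (a p q : ℕ) (hp : 0 < p) :
    ((Finset.Icc 1 (p * q)).filter (fun r => p ∣ a + r)).card = q := by
  have h1 : ((Finset.Icc 1 (p * q)).filter (fun r => p ∣ a + r)).card =
      ((Finset.Ioc a (a + p * q)).filter (p ∣ ·)).card := by
    refine Finset.card_bij (fun r _ => a + r) ?_ ?_ ?_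
    · intro r hr
      simp only [Finset.mem_filter, Finset.mem_Icc, Finset.mem_Ioc] at hr ⊢
      exact ⟨⟨by omega, by omega⟩, hr.2⟩
    · intro r _ r' _ h
      omega
    · intro c hc
      simp only [Finset.mem_filter, Finset.mem_Ioc] at hc
      refine ⟨c - a, ?_, by omega⟩
      simp only [Finset.mem_filter, Finset.mem_Icc]
      exact ⟨⟨by omega, by omega⟩, by rw [show a + (c - a) = c by omega]; exact hc.2⟩
  have h2 : (Finset.Ioc 0 (a + p * q)).filter (p ∣ ·) =
      (Finset.Ioc 0 a).filter (p ∣ ·) ∪ (Finset.Ioc a (a + p * q)).filter (p ∣ ·) := by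
    rw [← Finset.filter_union, Finset.Ioc_union_Ioc_eq_Ioc (by omega) (by omega)]
  have h3 : Disjoint ((Finset.Ioc 0 a).filter (p ∣ ·))
      ((Finset.Ioc a (a + p * q)).filter (p ∣ ·)) := by
    refine Finset.disjoint_filter_filter (Finset.disjoint_left.2 fun x hx hx' => ?_)
    rw [Finset.mem_Ioc] at hx hx'
    omega
  have h4 := congrArg Finset.card h2
  rw [Finset.card_union_of_disjoint h3, Nat.Ioc_filter_dvd_card_eq_div,
    Nat.Ioc_filter_dvd_card_eq_div, Nat.add_mul_div_left _ _ hp] at h4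
  omega

/-- On average over the shifts, the excess of the ruler function over `K` is at most `2⁻ᴷ`. -/
theorem sum_padicValNat_sub_le (a K M : ℕ) (ha : a < 2 ^ M) :
    2 ^ K * ∑ r ∈ Finset.Icc 1 (2 ^ M), (padicValNat 2 (a + r) - K) ≤ 2 ^ M := by
  -- The excess over `K` counts the exponents `h` above `K` with `2 ^ h ∣ a + r`, and none exceeds
  -- `M` because `a + r < 2 ^ (M + 1)`. Each `h` occurs for `2 ^ (M - h)` shifts, which leaves a
  -- geometric series.
  have h1 : ∀ r ∈ Finset.Icc 1 (2 ^ M), padicValNat 2 (a + r) - K ≤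
      ∑ h ∈ Finset.Ioc K M, if 2 ^ h ∣ a + r then 1 else 0 := by
    intro r hr
    rw [Finset.mem_Icc] at hr
    rw [← Finset.card_filter]
    have hle : padicValNat 2 (a + r) ≤ M := by
      by_contra hc
      have h2 : 2 ^ (M + 1) ∣ a + r := by
        rw [padicValNat_dvd_iff_le (by omega)]
        omega
      have := Nat.le_of_dvd (by omega) h2
      rw [pow_succ] at this
      omega
    rw [← Nat.card_Ioc]
    refine Finset.card_le_card fun h hh => ?_
    rw [Finset.mem_Ioc] at hh
    rw [Finset.mem_filter, Finset.mem_Ioc, padicValNat_dvd_iff_le (by omega)]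
    exact ⟨⟨hh.1, hh.2.trans hle⟩, hh.2⟩
  have h2 : ∑ r ∈ Finset.Icc 1 (2 ^ M), (padicValNat 2 (a + r) - K) ≤
      ∑ h ∈ Finset.Ioc K M, 2 ^ (M - h) := by
    refine (Finset.sum_le_sum h1).trans ?_
    rw [Finset.sum_comm]
    refine Finset.sum_le_sum fun h hh => ?_
    rw [Finset.mem_Ioc] at hh
    rw [← Finset.card_filter]
    have := card_filter_dvd_add a (2 ^ h) (2 ^ (M - h)) (by positivity)
    rw [← pow_add, show h + (M - h) = M by omega] at this
    exact this.le
  have h3 : ∀ M, K ≤ M → 2 ^ K * (∑ h ∈ Finset.Ioc K M, 2 ^ (M - h) + 1) ≤ 2 ^ M := by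
    intro M hKM
    induction M, hKM using Nat.le_induction with
    | base => simp
    | succ M hKM ih =>
      have h4 : ∑ h ∈ Finset.Ioc K (M + 1), 2 ^ (M + 1 - h) =
          2 * ∑ h ∈ Finset.Ioc K M, 2 ^ (M - h) + 1 := by
        rw [Finset.sum_Ioc_succ_top hKM, Finset.mul_sum]
        congr 1
        · refine Finset.sum_congr rfl fun h hh => ?_
          rw [Finset.mem_Ioc] at hh
          rw [show M + 1 - h = (M - h) + 1 by omega, pow_succ, mul_comm]
        · simp
      rw [h4, pow_succ]
      calc _ = (2 ^ K * (∑ h ∈ Finset.Ioc K M, 2 ^ (M - h) + 1)) * 2 := by ring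
        _ ≤ _ := Nat.mul_le_mul_right _ ih
  by_cases hKM : K ≤ M
  · exact (Nat.mul_le_mul_left _ (h2.trans (Nat.le_succ _))).trans (h3 M hKM)
  · rw [Finset.Ioc_eq_empty (by omega)] at h2
    simp only [Finset.sum_empty, nonpos_iff_eq_zero] at h2
    rw [h2]
    simp

/-! ### Moving fingers in unit steps -/

/-- At most one finger moves, along an edge of `T`. -/
def UnitStep {n k : ℕ} (T : BinaryTree (Fin n)) (p p' : Fin k → Fin n) : Prop :=
  ∃ c, ∀ i, p' i = p i ∨ (p' i = c ∧ (treeGraph T).Adj (p i) c)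

/-- The cost of request number `t`, and `0` if there is none. -/
noncomputable def requestCost {n m k : ℕ} (T : BinaryTree (Fin n)) (X : Fin m → Fin n)
    (f : Fin m → Fin k) (ℓ : Fin k → Fin n) (t : ℕ) : ℕ :=
  if h : t < m then 1 + treeDist T (X ⟨t, h⟩) (fingerPos X f ℓ t (f ⟨t, h⟩)) else 0

theorem strategyCost_eq {n m k : ℕ} (T : BinaryTree (Fin n)) (X : Fin m → Fin n)
    (f : Fin m → Fin k) (ℓ : Fin k → Fin n) :
    strategyCost T X f ℓ = ∑ t ∈ Finset.range m, requestCost T X f ℓ t := by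
  rw [strategyCost, Finset.sum_range]
  refine Finset.sum_congr rfl fun t _ => ?_
  simp [requestCost]

/-- A request of cost `1 + d` receives `1 + d` units of time: `d` for a shortest walk of its finger
and one to rest. So the arrival time `τ t` falls strictly before the time of the next request
begins. -/
theorem exists_unitSteps {n m k : ℕ} {T : BinaryTree (Fin n)} (hT : IsBST T) (hk : 0 < k)
    (X : Fin m → Fin n) (f : Fin m → Fin k) (ℓ : Fin k → Fin n) :
    ∃ (P : ℕ → Fin k → Fin n) (τ : Fin m → ℕ), Monotone τ ∧ (∀ t, τ t < strategyCost T X f ℓ) ∧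
      (∀ t, P (τ t) (f t) = X t) ∧ ∀ s, UnitStep T (P s) (P (s + 1)) := by
  set C : ℕ → ℕ := fun j => ∑ t ∈ Finset.range j, requestCost T X f ℓ t with hC
  have hCmono : Monotone C := fun a b hab => Finset.sum_le_sum_of_subset (Finset.range_mono hab)
  have key : ∀ j ≤ m, ∃ (P : ℕ → Fin k → Fin n) (τ : ℕ → ℕ), (∀ s, C j ≤ s →
      P s = fingerPos X f ℓ j) ∧ (∀ s, UnitStep T (P s) (P (s + 1))) ∧
      ∀ t (h : t < j) (h' : t < m), C t ≤ τ t ∧ τ t < C (t + 1) ∧ P (τ t) (f ⟨t, h'⟩) = X ⟨t, h'⟩ := by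
    intro j
    induction j with
    | zero =>
      intro _
      exact ⟨fun _ => ℓ, fun _ => 0, fun _ _ => rfl, fun _ => ⟨ℓ ⟨0, hk⟩, fun _ => .inl rfl⟩, by simp⟩
    | succ j ih =>
      intro hj
      obtain ⟨P, τ, hP, hstep, hτ⟩ := ih (by omega)
      have hjm : j < m := by omega
      set p := fingerPos X f ℓ j with hp
      set i₀ := f ⟨j, hjm⟩ with hi₀
      obtain ⟨w, hw⟩ := (treeGraph_preconnected hT (p i₀) (X ⟨j, hjm⟩)).exists_walk_length_eq_dist
      have hcost : C (j + 1) = C j + (1 + w.length) := by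
        have h1 : C (j + 1) = C j + requestCost T X f ℓ j := Finset.sum_range_succ _ _
        rw [h1, requestCost, dif_pos hjm, hw, SimpleGraph.dist_comm]
        rfl
      let Q : ℕ → Fin k → Fin n := fun s =>
        if s ≤ C j then P s else Function.update p i₀ (w.getVert (s - C j))
      have hQ1 : ∀ s, s ≤ C j → Q s = P s := fun s hs => by simp [Q, hs]
      have hQ2 : ∀ s, C j ≤ s → Q s = Function.update p i₀ (w.getVert (s - C j)) := by
        intro s hs
        by_cases h : s ≤ C j
        · obtain rfl : s = C j := le_antisymm h hs
          rw [hQ1 _ h, hP _ hs, Nat.sub_self, SimpleGraph.Walk.getVert_zero,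
            Function.update_eq_self]
        · simp [Q, h]
      refine ⟨Q, fun t => if t = j then C j + w.length else τ t, ?_, ?_, ?_⟩
      · intro s hs
        rw [hQ2 s (by omega), SimpleGraph.Walk.getVert_of_length_le _ (by omega), fingerPos,
          dif_pos hjm]
      · intro s
        by_cases hs : s < C j
        · rw [hQ1 s hs.le, hQ1 (s + 1) hs]
          exact hstep s
        · rw [hQ2 s (by omega), hQ2 (s + 1) (by omega)]
          refine ⟨w.getVert (s + 1 - C j), fun i => ?_⟩
          by_cases hi : i = i₀
          · subst hi
            simp only [Function.update_self]
            by_cases hlt : s - C j < w.length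
            · right
              have := w.adj_getVert_succ hlt
              rw [show s + 1 - C j = s - C j + 1 by omega]
              exact ⟨trivial, this⟩
            · left
              rw [SimpleGraph.Walk.getVert_of_length_le _ (by omega),
                SimpleGraph.Walk.getVert_of_length_le _ (by omega)]
          · left
            simp [hi]
      · intro t ht ht'
        by_cases htj : t = j
        · subst htj
          simp only [if_true]
          refine ⟨by omega, by omega, ?_⟩
          rw [hQ2 _ (by omega), ← hi₀, Function.update_self,
            SimpleGraph.Walk.getVert_of_length_le _ (by omega)]
        · obtain ⟨h1, h2, h3⟩ := hτ t (by omega) ht'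
          simp only [htj, if_false]
          refine ⟨h1, h2, ?_⟩
          have := hCmono (show t + 1 ≤ j by omega)
          rw [hQ1 _ (by omega), h3]
  obtain ⟨P, τ, -, h2, h3⟩ := key m le_rfl
  refine ⟨P, fun t => τ t, fun t t' htt => ?_, fun t => ?_, fun t => (h3 t t.2 t.2).2.2, h2⟩
  · rcases htt.eq_or_lt with rfl | hlt
    · exact le_rfl
    · have h4 := (h3 t t.2 t.2).2.1
      have h5 := (h3 t' t'.2 t'.2).1
      have h6 := hCmono (show (t : ℕ) + 1 ≤ t' from hlt)
      dsimp only
      omega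
  · rw [strategyCost_eq]
    exact (h3 t t.2 t.2).2.1.trans_le (hCmono t.2)

/-! ### Phases -/

/-- The keys visited by the fingers from time `a` to time `a + j`. -/
def visited {n k : ℕ} (P : ℕ → Fin k → Fin n) (a j : ℕ) : Finset (Fin n) :=
  (Finset.Icc a (a + j)).biUnion fun s => Finset.univ.image (P s)

theorem mem_visited {n k : ℕ} {P : ℕ → Fin k → Fin n} {a j : ℕ} {v : Fin n} :
    v ∈ visited P a j ↔ ∃ s, a ≤ s ∧ s ≤ a + j ∧ ∃ i, P s i = v := by
  simp [visited, and_assoc]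

theorem card_visited_le {n k : ℕ} {T : BinaryTree (Fin n)} {P : ℕ → Fin k → Fin n}
    (hP : ∀ s, UnitStep T (P s) (P (s + 1))) (a j : ℕ) : (visited P a j).card ≤ k + j := by
  induction j with
  | zero =>
    have : visited P a 0 = Finset.univ.image (P a) := by simp [visited]
    rw [this]
    exact Finset.card_image_le.trans (by simp)
  | succ j ih =>
    obtain ⟨c, hc⟩ := hP (a + j)
    have hsub : visited P a (j + 1) ⊆ insert c (visited P a j) := by
      intro v hv
      rw [mem_visited] at hv
      rw [Finset.mem_insert, mem_visited]
      obtain ⟨s, h1, h2, i, rfl⟩ := hv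
      by_cases hs : s ≤ a + j
      · exact .inr ⟨s, h1, hs, i, rfl⟩
      · obtain rfl : s = a + j + 1 := by omega
        rcases hc i with h | h
        · exact .inr ⟨a + j, by omega, le_rfl, i, h.symm⟩
        · exact .inl h.1
    exact (Finset.card_le_card hsub).trans ((Finset.card_insert_le _ _).trans (by omega))

/-- The ends of an edge lie on the same side of any third key, so a finger can change sides of `u`
only by visiting `u`. -/
theorem side_iff_of_unitSteps {n k : ℕ} {T : BinaryTree (Fin n)} (hT : IsBST T)
    {P : ℕ → Fin k → Fin n} (hP : ∀ s, UnitStep T (P s) (P (s + 1))) {a j : ℕ} {u : Fin n}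
    (hu : u ∉ visited P a j) (i : Fin k) (b : Bool) (q : ℕ) (hq : q ≤ j) :
    InSub b T u (P a i) ↔ InSub b T u (P (a + q) i) := by
  induction q with
  | zero => rfl
  | succ q ih =>
    rw [ih (by omega)]
    have hne : ∀ r ≤ j, u ≠ P (a + r) i := by
      rintro r hr rfl
      exact hu (mem_visited.2 ⟨a + r, by omega, by omega, i, rfl⟩)
    obtain ⟨c, hc⟩ := hP (a + q)
    have h2 := hne (q + 1) hq
    rw [← add_assoc] at h2 ⊢
    rcases hc i with h | ⟨h, hadj⟩
    · rw [h]
    · rw [← h] at hadj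
      exact treeGraph_adj_side hT hadj (hne q (by omega)) h2 b

/-- The partner of a visited key is the position of the same finger at time `a + q`. Consecutive
phases share an endpoint, so `q = k` links a phase to the next one and `q = 0` to the previous one.
-/
theorem link_visited {n k : ℕ} {T : BinaryTree (Fin n)} (hT : IsBST T)
    {P : ℕ → Fin k → Fin n} (hP : ∀ s, UnitStep T (P s) (P (s + 1))) {a j : ℕ} {V' : Finset (Fin n)}
    {q : ℕ} (hq : q ≤ j) (hV' : ∀ i, P (a + q) i ∈ V') :
    (searchOrder T hT).Link (visited P a j) V' := by
  intro v hv
  obtain ⟨s, h1, h2, i, rfl⟩ := mem_visited.1 hv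
  refine ⟨P (a + q) i, mem_visited.2 ⟨_, by omega, by omega, i, rfl⟩, hV' i, fun u hu => ?_⟩
  have key : ∀ b, InSub b T u (P s i) ↔ InSub b T u (P (a + q) i) := by
    intro b
    have h3 := side_iff_of_unitSteps hT hP hu i b (s - a) (by omega)
    rw [show a + (s - a) = s by omega] at h3
    exact h3.symm.trans (side_iff_of_unitSteps hT hP hu i b q hq)
  exact ⟨key true, key false⟩

/-! ### The bound for a fixed shift of the rulers -/

section Shift

variable {n k : ℕ} {T : BinaryTree (Fin n)}

theorem exists_touchedSet_between (hT : IsBST T) {g l : Fin n → ℕ}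
    (hg : (searchOrder T hT).IsRuler g) (hl : (searchOrder T hT).dual.IsRuler l)
    {V : ℕ → Finset (Fin n)} {H : ℕ → ℕ} (hgH : ∀ b, ∀ v ∈ V b, g v ≤ H b)
    (hlH : ∀ b, ∀ v ∈ V b, l v ≤ H b)
    (hfwd : ∀ b, (searchOrder T hT).Link (V b) (V (b + 1)))
    (hbwd : ∀ b, (searchOrder T hT).Link (V (b + 1)) (V b)) (s D : ℕ) (x y : Fin n) (hD : 1 ≤ D)
    (hxy : x ≠ y) (hx : x ∈ (searchOrder T hT).touchedSet (V s) g l (H s))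
    (hy : y ∈ (searchOrder T hT).touchedSet (V (s + D)) g l (H (s + D))) :
    ∃ c z, s ≤ c ∧ c ≤ s + D ∧ z ∈ (searchOrder T hT).touchedSet (V c) g l (H c) ∧
      (x ≤ z ∧ z ≤ y ∨ y ≤ z ∧ z ≤ x) ∧ ¬(z = x ∧ c = s) ∧ ¬(z = y ∧ c = s + D) := by
  simp only [SearchOrder.mem_touchedSet] at hx hy ⊢
  rcases hxy.lt_or_gt with h | h
  · obtain ⟨c, z, h1, h2, h3, h4, h5, h6, h7⟩ := SearchOrder.exists_touched_between_of_lt hg hl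
      hgH hlH hfwd hbwd s D hD x y h hx hy
    refine ⟨c, z, h1, h2, h3, .inl ⟨?_, ?_⟩, h6, h7⟩
    · exact h4.elim (fun h => h.ge) (fun h => le_of_lt h)
    · exact h5.elim (fun h => h.le) (fun h => le_of_lt h)
  · obtain ⟨c, z, h1, h2, h3, h4, h5, h6, h7⟩ := SearchOrder.exists_touched_between_of_lt
      (S := (searchOrder T hT).dual) hl hg hlH hgH (fun b => (hfwd b).dual) (fun b => (hbwd b).dual)
      s D hD x y h (SearchOrder.dual_touched.2 hx) (SearchOrder.dual_touched.2 hy)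
    refine ⟨c, z, h1, h2, SearchOrder.dual_touched.1 h3, .inr ⟨?_, ?_⟩, h6, h7⟩
    · exact h5.elim (fun h => h.ge) (fun h => le_of_lt h)
    · exact h4.elim (fun h => h.le) (fun h => le_of_lt h)

theorem OPT_le_of_isRuler {m : ℕ} (hT : IsBST T) (hk : 0 < k) {X : Fin m → Fin n}
    {P : ℕ → Fin k → Fin n} (hP : ∀ s, UnitStep T (P s) (P (s + 1))) {τ : Fin m → ℕ}
    (hτ : Monotone τ) {f : Fin m → Fin k} (hX : ∀ t, P (τ t) (f t) = X t) {N : ℕ}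
    (hN : ∀ t, τ t ≤ N) {K : ℕ} (hK : k < 2 ^ K) {g l : Fin n → ℕ}
    (hg : (searchOrder T hT).IsRuler g) (hl : (searchOrder T hT).dual.IsRuler l) {H : ℕ → ℕ}
    (hgH : ∀ b, ∀ v ∈ visited P (k * b) k, g v ≤ H b)
    (hlH : ∀ b, ∀ v ∈ visited P (k * b) k, l v ≤ H b) :
    OPT X ≤ ∑ t, (K + 7 + (H (τ t / k - 1) + H (τ t / k))) +
      ∑ c ∈ Finset.range (N / k), 8 * (k * (16 * (H (c - 1) + H c) + 88) +
        k * (16 * (H c + H (c + 1)) + 88)) := by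
  set S := searchOrder T hT with hS
  set V : ℕ → Finset (Fin n) := fun b => visited P (k * b) k with hV
  set W : ℕ → Finset (Fin n) := fun b => S.touchedSet (V b) g l (H b) with hW
  have hVmem : ∀ b i, P (k * b) i ∈ V b := fun b i =>
    mem_visited.2 ⟨k * b, le_rfl, by omega, i, rfl⟩
  have hfwd : ∀ b, S.Link (V b) (V (b + 1)) := fun b =>
    link_visited hT hP le_rfl fun i => by
      rw [show k * b + k = k * (b + 1) by ring]
      exact hVmem (b + 1) i
  have hbwd : ∀ b, S.Link (V (b + 1)) (V b) := fun b =>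
    link_visited hT hP (Nat.zero_le k) fun i =>
      mem_visited.2 ⟨k * b + k, by omega, le_rfl, i, by simp [mul_add]⟩
  have hWcard : ∀ b, (W b).card ≤ 2 * k * (8 * H b + 22) := fun b =>
    (SearchOrder.card_touchedSet_le _ _).trans
      (Nat.mul_le_mul_right _ ((card_visited_le hP _ _).trans (by omega)))
  have hcard : ∀ c ≤ N / k, (boundarySet W (N / k) c).card ≤ k * (16 * (H (c - 1) + H c) + 88) := by
    intro c hc
    rw [boundarySet, if_pos hc]
    calc (W (c - 1) ∪ W c).card ≤ _ := Finset.card_union_le _ _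
      _ ≤ _ := Nat.add_le_add (hWcard _) (hWcard _)
      _ = _ := by ring
  have hcover : ∀ b u, ∃ c, b ≤ c ∧ u ∈ boundarySet W (N / k) c := fun b u =>
    ⟨b + (N / k + 1), Nat.le_add_right _ _, by
      rw [boundarySet, if_neg (by omega)]
      exact Finset.mem_univ u⟩
  have hdiv : ∀ t, τ t / k ≤ N / k := fun t => Nat.div_le_div_right (hN t)
  have hXmem : ∀ t, X t ∈ boundarySet W (N / k) (τ t / k) := by
    intro t
    rw [boundarySet, if_pos (hdiv t), Finset.mem_union]
    right
    rw [hW, SearchOrder.mem_touchedSet]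
    have h1 := Nat.div_add_mod (τ t) k
    have h2 := Nat.mod_lt (τ t) hk
    exact .inl (.inl (mem_visited.2 ⟨τ t, by omega, by omega, f t, hX t⟩))
  -- The exponent collects `K` for the factor `k`, `7` for the constant `128`, and `h` for the
  -- factor `h + 1`.
  have hpow : ∀ c ≤ N / k, (boundarySet W (N / k) c).card < 2 ^ (K + 7 + (H (c - 1) + H c)) := by
    intro c hc
    set h := H (c - 1) + H c
    have h1 : h + 1 ≤ 2 ^ h := Nat.lt_two_pow_self
    calc _ ≤ _ := hcard c hc
      _ < k * (128 * (h + 1)) := Nat.mul_lt_mul_of_pos_left (by omega) hk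
      _ ≤ 2 ^ K * (128 * 2 ^ h) := Nat.mul_le_mul hK.le (Nat.mul_le_mul_left _ h1)
      _ = _ := by rw [pow_add, pow_add]; ring
  refine (OPT_le_of_satisfied X hcover (satisfied_boundarySet W (N / k)
    (exists_touchedSet_between hT hg hl hgH hlH hfwd hbwd)) (fun c => K + 7 + (H (c - 1) + H c))
    (fun t => τ t / k) (fun _ _ h => Nat.div_le_div_right (hτ h)) (N / k) hdiv hXmem hpow).trans ?_
  refine Nat.add_le_add_left (Finset.sum_le_sum fun c hc => ?_) _
  rw [Finset.mem_range] at hc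
  exact Nat.mul_le_mul_left 8 (Nat.add_le_add (hcard c hc.le) (hcard (c + 1) hc))

end Shift

/-! ### Averaging over the shifts -/

/-- The largest ruler value, for the order or its dual, of a key in `V`. -/
noncomputable def maxRuler {α : Type} [Fintype α] (S : SearchOrder α) (V : Finset α) (r : ℕ) : ℕ :=
  V.sup fun v => max (S.ruler r v) (S.dual.ruler r v)

theorem sum_ruler_sub_le {α : Type} [Fintype α] (S : SearchOrder α) (K M : ℕ)
    (hM : Fintype.card α < 2 ^ M) (v : α) :
    2 ^ K * ∑ r ∈ Finset.Icc 1 (2 ^ M), (S.ruler r v - K) ≤ 2 ^ M :=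
  sum_padicValNat_sub_le _ K M ((SearchOrder.leftDepth_lt_card v).trans hM)

theorem sum_maxRuler_le {α : Type} [Fintype α] (S : SearchOrder α) {K M : ℕ}
    (hM : Fintype.card α < 2 ^ M) {V : Finset α} (hV : V.card ≤ 2 * 2 ^ K) :
    ∑ r ∈ Finset.Icc 1 (2 ^ M), maxRuler S V r ≤ 2 ^ M * (K + 4) := by
  -- A maximum is at most `K` plus the sum of all excesses over `K`. With at most `2 * 2 ^ K` keys,
  -- two rulers, and a mean excess of at most `2 ^ (-K)` each, the mean of that sum is at most `4`.
  have h1 : ∀ r, maxRuler S V r ≤ K + ∑ v ∈ V, ((S.ruler r v - K) + (S.dual.ruler r v - K)) := by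
    intro r
    refine Finset.sup_le fun v hv => ?_
    have := Finset.single_le_sum (f := fun v => (S.ruler r v - K) + (S.dual.ruler r v - K))
      (fun _ _ => Nat.zero_le _) hv
    omega
  set A := ∑ v ∈ V, ∑ r ∈ Finset.Icc 1 (2 ^ M), ((S.ruler r v - K) + (S.dual.ruler r v - K)) with hA
  have h2 : 2 ^ K * A ≤ 2 ^ K * (4 * 2 ^ M) := by
    rw [hA, Finset.mul_sum]
    calc _ ≤ ∑ v ∈ V, 2 * 2 ^ M := Finset.sum_le_sum fun v _ => by
          rw [Finset.sum_add_distrib, mul_add, two_mul (2 ^ M)]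
          exact Nat.add_le_add (sum_ruler_sub_le S K M hM v) (sum_ruler_sub_le S.dual K M hM v)
      _ = V.card * (2 * 2 ^ M) := by rw [Finset.sum_const, smul_eq_mul]
      _ ≤ 2 * 2 ^ K * (2 * 2 ^ M) := Nat.mul_le_mul_right _ hV
      _ = _ := by ring
  have h3 : A ≤ 4 * 2 ^ M := Nat.le_of_mul_le_mul_left h2 (by positivity)
  calc _ ≤ ∑ r ∈ Finset.Icc 1 (2 ^ M),
        (K + ∑ v ∈ V, ((S.ruler r v - K) + (S.dual.ruler r v - K))) :=
        Finset.sum_le_sum fun r _ => h1 r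
    _ = 2 ^ M * K + A := by
        rw [Finset.sum_add_distrib, Finset.sum_const, Nat.card_Icc, Finset.sum_comm, smul_eq_mul,
          Nat.add_sub_cancel]
    _ ≤ _ := by rw [mul_add]; omega

theorem OPT_le_mul_strategyCost {n m k : ℕ} {T : BinaryTree (Fin n)} (hT : IsBST T) (hk : 0 < k)
    (X : Fin m → Fin n) (f : Fin m → Fin k) (ℓ : Fin k → Fin n) :
    OPT X ≤ 4000 * (Nat.log 2 k + 2) * strategyCost T X f ℓ := by
  obtain ⟨P, τ, hτ, hτN, hX, hP⟩ := exists_unitSteps hT hk X f ℓ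
  set N := strategyCost T X f ℓ with hN
  have hmN : m ≤ N := by
    calc m = ∑ _t : Fin m, 1 := by simp
      _ ≤ N := Finset.sum_le_sum fun t _ => by omega
  set K := Nat.log 2 k + 1 with hK
  have hkK : k < 2 ^ K := Nat.lt_pow_succ_log_self (by norm_num) k
  set S := searchOrder T hT with hS
  set H : ℕ → ℕ → ℕ := fun r b => maxRuler S (visited P (k * b) k) r with hH
  have hsum : ∀ b, ∑ r ∈ Finset.Icc 1 (2 ^ n), H r b ≤ 2 ^ n * (K + 4) := fun b =>
    sum_maxRuler_le S (by simpa using Nat.lt_two_pow_self)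
      ((card_visited_le hP _ _).trans (by omega))
  have hle : ∀ r b, ∀ v ∈ visited P (k * b) k, max (S.ruler r v) (S.dual.ruler r v) ≤ H r b :=
    fun r b v hv => Finset.le_sup (f := fun v => max (S.ruler r v) (S.dual.ruler r v)) hv
  -- One shift serves all phases, and the left side does not depend on it, so the bounds may be
  -- averaged. Left and right depths are below `n < 2 ^ n`, which makes `2 ^ n` shifts enough.
  have hOPT : ∀ r ∈ Finset.Icc 1 (2 ^ n), _ := fun r hr =>
    OPT_le_of_isRuler hT hk hP hτ hX (fun t => (hτN t).le) hkK
      (SearchOrder.isRuler_ruler S (Finset.mem_Icc.1 hr).1)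
      (SearchOrder.isRuler_ruler S.dual (Finset.mem_Icc.1 hr).1) (H := H r)
      (fun b v hv => (le_max_left _ _).trans (hle r b v hv))
      (fun b v hv => (le_max_right _ _).trans (hle r b v hv))
  have htot := Finset.sum_le_sum hOPT
  rw [Finset.sum_const, Nat.card_Icc, Nat.add_sub_cancel, smul_eq_mul, Finset.sum_add_distrib,
    Finset.sum_comm, Finset.sum_comm (t := Finset.range (N / k))] at htot
  have h1 : ∀ b b', ∑ r ∈ Finset.Icc 1 (2 ^ n), (K + 7 + (H r b + H r b')) ≤
      2 ^ n * (3 * K + 15) := by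
    intro b b'
    simp only [Finset.sum_add_distrib, Finset.sum_const, Nat.card_Icc, Nat.add_sub_cancel,
      smul_eq_mul]
    linarith [hsum b, hsum b']
  have h2 : ∀ b b' b'', ∑ r ∈ Finset.Icc 1 (2 ^ n), 8 * (k * (16 * (H r b + H r b') + 88) +
      k * (16 * (H r b' + H r b'') + 88)) ≤ 2 ^ n * (k * (512 * K + 3456)) := by
    intro b b' b''
    have h3 : ∑ r ∈ Finset.Icc 1 (2 ^ n), (16 * (H r b + H r b') + 88 +
        (16 * (H r b' + H r b'') + 88)) ≤ 2 ^ n * (64 * K + 432) := by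
      simp only [Finset.sum_add_distrib, ← Finset.mul_sum, Finset.sum_const, Nat.card_Icc,
        Nat.add_sub_cancel, smul_eq_mul]
      linarith [hsum b, hsum b', hsum b'']
    calc _ = 8 * k * ∑ r ∈ Finset.Icc 1 (2 ^ n), (16 * (H r b + H r b') + 88 +
          (16 * (H r b' + H r b'') + 88)) := by
          rw [Finset.mul_sum]
          exact Finset.sum_congr rfl fun r _ => by ring
      _ ≤ 8 * k * (2 ^ n * (64 * K + 432)) := Nat.mul_le_mul_left _ h3
      _ = _ := by ring
  have h4 : 2 ^ n * OPT X ≤ 2 ^ n * (m * (3 * K + 15) + N / k * (k * (512 * K + 3456))) := by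
    refine htot.trans ((Nat.add_le_add (Finset.sum_le_sum fun t _ => h1 _ _)
      (Finset.sum_le_sum fun c _ => h2 _ _ _)).trans (le_of_eq ?_))
    simp only [Finset.sum_const, Finset.card_univ, Fintype.card_fin, Finset.card_range, smul_eq_mul]
    ring
  have h5 := Nat.le_of_mul_le_mul_left h4 (by positivity)
  calc OPT X ≤ _ := h5
    _ = m * (3 * K + 15) + N / k * k * (512 * K + 3456) := by ring
    _ ≤ N * (3 * K + 15) + N * (512 * K + 3456) := Nat.add_le_add (Nat.mul_le_mul_right _ hmN)
        (Nat.mul_le_mul_right _ (Nat.div_mul_le_self N k))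
    _ ≤ N * (4000 * (K + 1)) := by
        rw [← mul_add]
        exact Nat.mul_le_mul_left _ (by omega)
    _ = _ := by ring

/-! ### Conclusion -/

theorem OPT_eq_zero {n : ℕ} (X : Fin 0 → Fin n) : OPT X = 0 := by
  obtain ⟨T, r, -, h⟩ := OPT_attained X
  simpa [executionCost] using h

theorem OPT_le_mul_LF {n m k : ℕ} (hk : 0 < k) (X : Fin m → Fin n) :
    OPT X ≤ 4000 * (Nat.log 2 k + 2) * LF k X := by
  -- Without requests there may be no keys, hence no finger strategy, and `LF` may be the default
  -- infimum `0`. A request supplies a key.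
  obtain rfl | hm := Nat.eq_zero_or_pos m
  · rw [OPT_eq_zero]
    exact Nat.zero_le _
  · obtain ⟨T, f, ℓ, hT, h⟩ := LF_attained (X ⟨0, hm⟩).pos hk X
    rw [h]
    exact OPT_le_mul_strategyCost hT hk X f ℓ

/-- The binary logarithm of `k + 1` is at least `Nat.log 2 k`, and at least `1` since `k ≥ 1`; it is
used once for the first term and twice for the constant. -/
theorem log_add_two_le {k : ℕ} (hk : 0 < k) :
    (Nat.log 2 k + 2 : ℝ) ≤ 3 / Real.log 2 * Real.log (k + 1) := by
  have h2 : 0 < Real.log 2 := Real.log_pos (by norm_num)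
  have hk' : (1 : ℝ) ≤ k := by exact_mod_cast hk
  have h3 : Real.log 2 ≤ Real.log (k + 1) := Real.log_le_log (by norm_num) (by linarith)
  have h4 : Nat.log 2 k * Real.log 2 ≤ Real.log (k + 1) := by
    rw [← Real.log_pow]
    refine Real.log_le_log (by positivity) ?_
    have : 2 ^ Nat.log 2 k ≤ k := Nat.pow_log_le_self 2 hk.ne'
    have : (2 : ℝ) ^ Nat.log 2 k ≤ k := by exact_mod_cast this
    linarith
  rw [div_mul_eq_mul_div, le_div_iff₀ h2]
  linarith

end DynBST

theorem mainTheorem1 :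
    ∃ C : ℝ, 0 < C ∧
      ∀ (n m k : ℕ) (X : Fin m → Fin n), 1 ≤ k →
        (DynBST.OPT X : ℝ) ≤ C * Real.log ((k : ℝ) + 1) * (DynBST.LF k X : ℝ) := by
  have h2 : 0 < Real.log 2 := Real.log_pos (by norm_num)
  refine ⟨4000 * (3 / Real.log 2), by positivity, fun n m k X hk => ?_⟩
  calc (DynBST.OPT X : ℝ) ≤ 4000 * (Nat.log 2 k + 2) * DynBST.LF k X := by
        exact_mod_cast DynBST.OPT_le_mul_LF hk X
    _ ≤ 4000 * (3 / Real.log 2 * Real.log (k + 1)) * DynBST.LF k X := by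
        gcongr
        exact DynBST.log_add_two_le hk
    _ = _ := by ring
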